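/- Let $N\ge 3$. Consider the qubit POVMs $\{E_1,\dots,E_N\}$ with $E_j=\frac1N(\mathbf 1+\hat n_j\cdot\vec\sigma)$, where the unit vectors $\hat n_1,\dots,\hat n_N\in\mathbb R^3$ are the vertices of a regular $N$-gon in some plane (so that $\sum_j\hat n_j=0$). A frame function for this class is a function $f$ from the set of effects $\frac1N(\mathbf 1+\hat n\cdot\vec\sigma)$, $\hat n\in S^2$, to $[0,1]$ such that $\sum_{j=1}^N f(E_j)=1$ for every POVM of the class and such that $F(\hat n)=f\big(\frac1N(\mathbf 1+\hat n\cdot\vec\sigma)\big)$ is continuous on $S^2$. Write $c_{lm}=\int_{S^2}\overline{Y_{lm}}\,F$ for the coefficients of $F$ in its expansion in the spherical harmonics $Y_{lm}$, $-l\le m\le l$. The harmonic $l$ is called allowed if some frame function for the class has $c_{lm}\neq0$ for some $m$. 1. If $N$ is even, the allowed harmonics are exactly $l=0$ and all odd $l$. 2. If $N$ is odd, the allowed harmonics are exactly $l=0$ and the odd $l$ with $l\le N-2$. 3. For every density operator $W$ (a positive operator of unit trace), $f(E)=\operatorname{tr}(WE)$ is a frame function for the class. Every frame function for the class is of this form,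 i.e. obeys the quantum probability rule, if and only if $N=3$ (the trine). -/

import Mathlib

open MeasureTheory
open scoped ComplexOrder

noncomputable section

namespace QubitFrame

/-- Euclidean three-space; its unit sphere is the Bloch sphere. -/
abbrev E3 : Type := EuclideanSpace ℝ (Fin 3)

/-- The Bloch sphere, i.e. the set of unit vectors `n` of three-space. -/
abbrev BlochSphere : Type := Metric.sphere (0 : E3) 1

/-- Operators on a qubit. -/
abbrev QubitOp : Type := Matrix (Fin 2) (Fin 2) ℂ

/-! ### Spherical harmonics -/

/-- The Legendre polynomial `P_l`, by the Rodrigues formula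
`P_l = (2 ^ l l!)⁻¹ (d/dX) ^ l (X ^ 2 - 1) ^ l`. -/
def legendre (l : ℕ) : Polynomial ℝ :=
  Polynomial.C ((2 : ℝ) ^ l * (l.factorial : ℝ))⁻¹ *
    Polynomial.derivative^[l] ((Polynomial.X ^ 2 - 1) ^ l)

/-- The spherical harmonic `Y_{lm}` for `0 ≤ m ≤ l`, with the Condon-Shortley phase:
`Y_{lm} = √((2l+1)/(4π) · (l-m)!/(l+m)!) P_l^m(cos θ) exp(i m φ)`. Since
`P_l^m(x) = (-1)^m (1 - x²)^{m/2} (d/dx)^m P_l(x)` and `sin θ exp(i φ) = n_x + i n_y`, the last two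
factors are `(-1)^m ((d/dx)^m P_l)(n_z) (n_x + i n_y)^m`. -/
def sphericalHarmonicNat (l m : ℕ) (n : BlochSphere) : ℂ :=
  (Real.sqrt ((2 * (l : ℝ) + 1) / (4 * Real.pi) *
      (((l - m).factorial : ℝ) / ((l + m).factorial : ℝ))) : ℂ) *
    ((-1) ^ m * (((Polynomial.derivative^[m] (legendre l)).eval (n.1 2) : ℝ) : ℂ)) *
    ((n.1 0 : ℂ) + Complex.I * (n.1 1 : ℂ)) ^ m

/-- The spherical harmonic `Y_{lm}` for `-l ≤ m ≤ l`, where `Y_{l,-m} = (-1)^m conj Y_{lm}`. -/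
def sphericalHarmonic (l : ℕ) (m : ℤ) (n : BlochSphere) : ℂ :=
  if 0 ≤ m then sphericalHarmonicNat l m.natAbs n
  else (-1) ^ m.natAbs * (starRingEnd ℂ) (sphericalHarmonicNat l m.natAbs n)

/-- The surface measure of the Bloch sphere (of total mass `4π`). -/
def surfaceMeasure : Measure BlochSphere := (volume : Measure E3).toSphere

/-- The coefficient `c_{lm} = ∫ conj Y_{lm} F` of `F` in the expansion `F = ∑ c_{lm} Y_{lm}`. -/
def harmonicCoeff (F : BlochSphere → ℝ) (l : ℕ) (m : ℤ) : ℂ :=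
  ∫ n, (starRingEnd ℂ) (sphericalHarmonic l m n) * (F n : ℂ) ∂surfaceMeasure

/-! ### Effects, polygon measurements and frame functions -/

/-- `n · σ` for the Pauli matrices `σ`. -/
def pauliDot (n : E3) : QubitOp :=
  (n 0 : ℂ) • !![0, 1; 1, 0] + (n 1 : ℂ) • !![0, -Complex.I; Complex.I, 0] +
    (n 2 : ℂ) • !![1, 0; 0, -1]

/-- The operator `(1 + n · σ) / N`. -/
def effect (N : ℕ) (n : BlochSphere) : QubitOp :=
  (N : ℂ)⁻¹ • (1 + pauliDot n.1)

/-- The allowed effects of `N`-outcome measurements: all `(1 + n · σ) / N` with `n` a unit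
vector. -/
abbrev AllowedEffect (N : ℕ) : Type := {E : QubitOp // ∃ n : BlochSphere, E = effect N n}

/-- The allowed effect with Bloch vector `n`. -/
def allowedEffect (N : ℕ) (n : BlochSphere) : AllowedEffect N := ⟨effect N n, n, rfl⟩

/-- A POVM: positive operators that sum to the identity. -/
def IsPOVM {N : ℕ} (E : Fin N → QubitOp) : Prop :=
  (∀ j, (E j).PosSemidef) ∧ ∑ j, E j = 1

/-- The points `n 0, …, n (N-1)` are the vertices of a regular `N`-gon (with some centre and some
circumradius) in some plane of three-space. -/
def IsRegularPolygon {N : ℕ} (n : Fin N → E3) : Prop :=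
  ∃ (c u v : E3) (r : ℝ), 0 < r ∧ ‖u‖ = 1 ∧ ‖v‖ = 1 ∧ inner ℝ u v = 0 ∧
    ∀ j : Fin N, n j = c + r • (Real.cos (2 * Real.pi * (j : ℝ) / (N : ℝ)) • u +
      Real.sin (2 * Real.pi * (j : ℝ) / (N : ℝ)) • v)

/-- The restricted class of measurements: POVMs `{(1 + n_j · σ) / N}` whose unit vectors `n_j` form
a regular `N`-gon in a plane. The class is invariant under rotations. -/
def IsPolygonPOVM {N : ℕ} (E : Fin N → AllowedEffect N) : Prop :=
  IsPOVM (fun j => (E j).1) ∧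
    ∃ n : Fin N → BlochSphere, IsRegularPolygon (fun j => (n j).1) ∧
      ∀ j, E j = allowedEffect N (n j)

/-- The function `F(n) = f((1 + n · σ) / N)` on the Bloch sphere. -/
def blochFunction {N : ℕ} (f : AllowedEffect N → ℝ) (n : BlochSphere) : ℝ :=
  f (allowedEffect N n)

/-- Frame functions for the regular `N`-gon measurements: `[0, 1]`-valued, normalized on every
measurement of the class, and continuous on the Bloch sphere. -/
structure IsFrameFunction {N : ℕ} (f : AllowedEffect N → ℝ) : Prop where
  mem_Icc : ∀ E, f E ∈ Set.Icc (0 : ℝ) 1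
  normalized : ∀ E : Fin N → AllowedEffect N, IsPolygonPOVM E → ∑ j, f (E j) = 1
  continuous : Continuous (blochFunction f)

/-- The harmonic `l` is allowed for regular `N`-gon measurements if some frame function contains
it, i.e. has a nonzero coefficient `c_{lm}`. -/
def AllowedHarmonic (N l : ℕ) : Prop :=
  ∃ f : AllowedEffect N → ℝ, IsFrameFunction f ∧
    ∃ m : ℤ, -(l : ℤ) ≤ m ∧ m ≤ (l : ℤ) ∧ harmonicCoeff (blochFunction f) l m ≠ 0

/-- `W` is a density operator: positive with unit trace. -/
def IsDensityOperator (W : QubitOp) : Prop := W.PosSemidef ∧ W.trace = 1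

/-- `f` obeys the quantum probability rule `f(E) = tr (W E)` for some density operator `W`. -/
def ObeysQuantumRule {N : ℕ} (f : AllowedEffect N → ℝ) : Prop :=
  ∃ W : QubitOp, IsDensityOperator W ∧ ∀ E : AllowedEffect N, (f E : ℂ) = (W * E.1).trace

end QubitFrame

end

/-! Subtracting `1 / N` from the Bloch function of a frame function leaves a continuous `G` whose
sum over every regular `N`-gon on a great circle is zero (`IsBalanced`). Everything rests on a
Funk–Hecke argument. Average `G` over the rotations about the first axis to obtain a function `Z` of
`x 0` alone. Balance becomes `∑ j, Z (R_j x) = 0`, where `R_j` rotates by `-2πj/N` about the third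
axis. Integrate this against `(x 0 + i x 2) ^ l`. Moving `R_j` to the other factor gives the power
of a linear form with isotropic coefficient vector and first coefficient `cos (2πj/N)`, and by
Laplace's formula `Z` sees such a power only through `cos (2πj/N) ^ l * P_l(x 0)`. Hence `(∑ j, cos
(2πj/N) ^ l) * ∫ G P_l(x 0) = 0`.

The cosine sum is nonzero when `l` is even, or when `l` and `N` are odd with `N ≤ l`; then `G` is
orthogonal to every zonal function `P_l(x · e)`. These span enough: powers of isotropic linear forms
are combinations of zonal functions, and each `Y_{lm}` is a finite Fourier coefficient of such
powers. So the harmonic `l ≠ 0` is absent. In the other cases `sum_cos_sin_pow_eq_zero` shows that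
`1/N + ε P_l(n_z)`, with `ε` small, is a frame function containing `l`.

For `N = 3` only `l = 1` survives in `G`. Testing `G` against the peaked kernels `(1 + x · e) ^ n`,
expanded in Legendre polynomials, shows that `G` is linear, and positivity of `f` bounds its slope
by that of a density operator. For `N ≥ 4` the function `1/N + ε n_z ^ 3` is a frame function that
is not affine in `n`. -/

noncomputable section

namespace QubitFrame


/-! ### Coefficients of powers of a quadratic and Legendre polynomials -/

/-- The coefficient of `X ^ (l + m)` in `(p X ^ 2 + 2 A X + q) ^ l` is `p ^ m` times this function
of `A` and `r = p q`. -/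
def trinomialCoeff (l m : ℕ) (A r : ℂ) : ℂ :=
  ∑ n ∈ Finset.range (l + 1), (l.choose n : ℂ) * (2 * A) ^ (l - n) *
    (if m ≤ n ∧ 2 ∣ n - m then (n.choose ((n - m) / 2) : ℂ) * r ^ ((n - m) / 2) else 0)

open Polynomial in
theorem coeff_binomial_sq_pow (n m : ℕ) (p q : ℂ) :
    ((C p * X ^ 2 + C q) ^ n).coeff (m + n) =
      if m ≤ n ∧ 2 ∣ n - m then
        p ^ m * ((n.choose ((n - m) / 2) : ℂ) * (p * q) ^ ((n - m) / 2)) else 0 := by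
  have key : ∀ k, ((C p * X ^ 2) ^ k * C q ^ (n - k) * ((n.choose k : ℕ) : ℂ[X])).coeff (m + n) =
      if m + n = 2 * k then p ^ k * q ^ (n - k) * n.choose k else 0 := by
    intro k
    have : (C p * X ^ 2) ^ k * C q ^ (n - k) * ((n.choose k : ℕ) : ℂ[X]) =
        C (p ^ k * q ^ (n - k) * n.choose k) * X ^ (2 * k) := by
      simp only [mul_pow, ← pow_mul, C_mul, C_pow, map_natCast]
      ring
    rw [this, coeff_C_mul_X_pow]
  rw [add_pow, finsetSum_coeff]
  simp only [key]
  split_ifs with h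
  · obtain ⟨h1, k, hk⟩ := h
    rw [Finset.sum_eq_single (m + k)]
    · have h2 : (n - m) / 2 = k := by omega
      have h3 : n - (m + k) = k := by omega
      have h4 : n.choose (m + k) = n.choose k := by
        rw [← Nat.choose_symm (show m + k ≤ n by omega), h3]
      rw [if_pos (by omega), h2, h3, h4]
      ring
    · intro b _ hb
      rw [if_neg (by omega)]
    · intro hb
      simp only [Finset.mem_range, not_lt] at hb
      omega
  · refine Finset.sum_eq_zero fun k hk => if_neg fun hk2 => h ?_
    rw [Finset.mem_range] at hk
    refine ⟨by omega, ⟨n - k, by omega⟩⟩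

open Polynomial in
theorem coeff_trinomial_pow (l m : ℕ) (A p q : ℂ) :
    ((C p * X ^ 2 + C (2 * A) * X + C q) ^ l).coeff (l + m) =
      p ^ m * trinomialCoeff l m A (p * q) := by
  have h0 : C p * X ^ 2 + C (2 * A) * X + C q = (C p * X ^ 2 + C q) + C (2 * A) * X := by ring
  rw [h0, add_pow, finsetSum_coeff, trinomialCoeff, Finset.mul_sum]
  refine Finset.sum_congr rfl fun n hn => ?_
  rw [Finset.mem_range] at hn
  have h1 : (C p * X ^ 2 + C q) ^ n * (C (2 * A) * X) ^ (l - n) * ((l.choose n : ℕ) : ℂ[X]) =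
      C ((2 * A) ^ (l - n) * l.choose n) * (C p * X ^ 2 + C q) ^ n * X ^ (l - n) := by
    simp only [mul_pow, C_mul, C_pow, map_natCast]
    ring
  rw [h1, show l + m = m + n + (l - n) by omega, coeff_mul_X_pow, coeff_C_mul,
    coeff_binomial_sq_pow]
  split_ifs <;> ring

/-- Weighted homogeneity, with weight 1 for `A` and weight 2 for `r`. It extends the link with `P_l`
from `r = z ^ 2 - 1` to arbitrary scale, including the degenerate scale `r = A ^ 2` used for
isotropic vectors. -/
theorem trinomialCoeff_zero_smul (l : ℕ) (a A r : ℂ) :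
    trinomialCoeff l 0 (a * A) (a ^ 2 * r) = a ^ l * trinomialCoeff l 0 A r := by
  rw [trinomialCoeff, trinomialCoeff, Finset.mul_sum]
  refine Finset.sum_congr rfl fun n hn => ?_
  rw [Finset.mem_range] at hn
  split_ifs with h
  · obtain ⟨_, k, hk⟩ := h
    have h2 : (n - 0) / 2 = k := by omega
    have h3 : l = (l - n) + 2 * k := by omega
    have h4 : a ^ l = a ^ (l - n) * a ^ (2 * k) := by rw [← pow_add, ← h3]
    rw [h2, h4]
    ring
  · ring

/-- This is the middle coefficient of `(X + 1) ^ (2 * l)`; here it suffices that all terms are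
natural numbers and the one at `n = 0` is positive. -/
theorem trinomialCoeff_zero_one_one_ne_zero (l : ℕ) : trinomialCoeff l 0 1 1 ≠ 0 := by
  have h : trinomialCoeff l 0 1 1 = ((∑ n ∈ Finset.range (l + 1), l.choose n * 2 ^ (l - n) *
      (if 0 ≤ n ∧ 2 ∣ n - 0 then n.choose ((n - 0) / 2) else 0) : ℕ) : ℂ) := by
    rw [trinomialCoeff]
    push_cast
    simp
  rw [h, Nat.cast_ne_zero, ← Nat.pos_iff_ne_zero]
  refine Finset.sum_pos' (fun _ _ => Nat.zero_le _) ⟨0, by simp, ?_⟩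
  simp

/-- Extraction of a coefficient of a polynomial by a sum over roots of unity. -/
theorem sum_primitiveRoot_mul_eval {M : ℕ} {ζ : ℂ} (hζ : IsPrimitiveRoot ζ M)
    (Q : Polynomial ℂ) (hQ : Q.natDegree < M) {k : ℕ} (hk : k < M) :
    ∑ j ∈ Finset.range M, ((ζ ^ j)⁻¹) ^ k * Q.eval (ζ ^ j) = M * Q.coeff k := by
  have hM : M ≠ 0 := by omega
  have hζ0 : ζ ≠ 0 := hζ.ne_zero hM
  simp only [Polynomial.eval_eq_sum_range' hQ, Finset.mul_sum]
  rw [Finset.sum_comm, Finset.sum_eq_single k]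
  · have : ∀ j ∈ Finset.range M, ((ζ ^ j)⁻¹) ^ k * (Q.coeff k * (ζ ^ j) ^ k) = Q.coeff k := by
      intro j _
      have : ζ ^ j ≠ 0 := pow_ne_zero _ hζ0
      rw [inv_pow, mul_left_comm, inv_mul_cancel₀ (pow_ne_zero _ this), mul_one]
    rw [Finset.sum_congr rfl this]
    simp
  · intro i hi hik
    rw [Finset.mem_range] at hi
    have h1 : ∀ j ∈ Finset.range M, ((ζ ^ j)⁻¹) ^ k * (Q.coeff i * (ζ ^ j) ^ i) =
        Q.coeff i * ((ζ ^ i) * (ζ ^ k)⁻¹) ^ j := by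
      intro j _
      rw [mul_pow, ← pow_mul, inv_pow, inv_pow, ← pow_mul, ← pow_mul, ← pow_mul, mul_comm k j,
        mul_comm i j]
      ring
    rw [Finset.sum_congr rfl h1, ← Finset.mul_sum]
    have hne : (ζ ^ i) * (ζ ^ k)⁻¹ ≠ 1 := by
      intro h
      have h2 : ζ ^ i = ζ ^ k := by
        have := pow_ne_zero k hζ0
        field_simp at h
        exact h
      exact hik (hζ.pow_inj hi hk h2)
    have hpow : ((ζ ^ i) * (ζ ^ k)⁻¹) ^ M = 1 := by
      rw [mul_pow, inv_pow, ← pow_mul, ← pow_mul, mul_comm i, mul_comm k, pow_mul, pow_mul,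
        hζ.pow_eq_one]
      simp
    rw [geom_sum_eq hne, hpow]
    simp
  · intro h
    simp at h
    omega

/-- Multiplication by `(2 t) ^ l` turns the power into `(p t ^ 2 + 2 A t + q) ^ l`, so the Fourier
coefficient `m` is the polynomial coefficient `l + m`. The degree is at most `2 l`, so `2 l + 1`
roots of unity replace the integral over the circle. -/
theorem sum_primitiveRoot_mul_pow (l m : ℕ) (hm : m ≤ l) {ζ : ℂ}
    (hζ : IsPrimitiveRoot ζ (2 * l + 1)) (A p q : ℂ) :
    ∑ j ∈ Finset.range (2 * l + 1),
      ((ζ ^ j)⁻¹) ^ m * (A + (p * ζ ^ j + q * (ζ ^ j)⁻¹) / 2) ^ l =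
    (2 * l + 1) * (2 ^ l)⁻¹ * (p ^ m * trinomialCoeff l m A (p * q)) := by
  have hζ0 : ζ ≠ 0 := hζ.ne_zero (by omega)
  rw [← coeff_trinomial_pow]
  have hdeg : ((Polynomial.C p * Polynomial.X ^ 2 + Polynomial.C (2 * A) * Polynomial.X +
      Polynomial.C q) ^ l).natDegree < 2 * l + 1 := by
    have h1 := Polynomial.natDegree_quadratic_le (a := p) (b := 2 * A) (c := q)
    have := Polynomial.natDegree_pow_le_of_le l h1
    omega
  have h := sum_primitiveRoot_mul_eval hζ _ hdeg (show l + m < 2 * l + 1 by omega)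
  have h2 : (2 * (l : ℂ) + 1) = ((2 * l + 1 : ℕ) : ℂ) := by push_cast; ring
  rw [h2, mul_right_comm, ← h, Finset.sum_mul]
  refine Finset.sum_congr rfl fun j _ => ?_
  have ht : ζ ^ j ≠ 0 := pow_ne_zero _ hζ0
  generalize ζ ^ j = t at ht
  have h3 : Polynomial.eval t ((Polynomial.C p * Polynomial.X ^ 2 +
      Polynomial.C (2 * A) * Polynomial.X + Polynomial.C q) ^ l) =
      (2 * t) ^ l * (A + (p * t + q * t⁻¹) / 2) ^ l := by
    rw [← mul_pow]
    simp only [Polynomial.eval_pow, Polynomial.eval_add, Polynomial.eval_mul, Polynomial.eval_C,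
      Polynomial.eval_X]
    congr 1
    field_simp
    ring
  rw [h3]
  generalize A + (p * t + q * t⁻¹) / 2 = B
  rw [mul_pow, pow_add, inv_pow, inv_pow]
  field_simp

-- For `p = 1` and `q = z ^ 2 - 1` the quadratic is `(X + z) ^ 2 - 1`, so its powers are Taylor
-- expansions of `(X ^ 2 - 1) ^ l` at `z`, and the coefficient `l + m` is the derivative in the
-- Rodrigues formula up to factorials.
open Polynomial in
theorem trinomialCoeff_eq_legendre (l m : ℕ) (z : ℝ) :
    ((l + m).factorial : ℂ) * trinomialCoeff l m z ((z : ℂ) ^ 2 - 1) =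
      2 ^ l * l.factorial * (((derivative^[m] (legendre l)).eval z : ℝ) : ℂ) := by
  have h := coeff_trinomial_pow l m z 1 ((z : ℂ) ^ 2 - 1)
  rw [one_pow, one_mul, one_mul] at h
  rw [← h]
  have h1 : (C (1 : ℂ) * X ^ 2 + C (2 * (z : ℂ)) * X + C ((z : ℂ) ^ 2 - 1)) ^ l =
      (taylor z ((X ^ 2 - 1) ^ l : ℝ[X])).map Complex.ofRealHom := by
    rw [taylor_apply]
    simp
    congr 1
    have : (C 2 : ℂ[X]) = 2 := rfl
    simp only [this]
    ring
  rw [h1, coeff_map, taylor_coeff]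
  have h2 : ∀ Q : ℝ[X], ((l + m).factorial : ℝ) * (hasseDeriv (l + m) Q).eval z =
      (derivative^[m] (derivative^[l] Q)).eval z := by
    intro Q
    rw [← Function.iterate_add_apply, add_comm m l, ← factorial_smul_hasseDeriv]
    simp
  have h3 := h2 ((X ^ 2 - 1) ^ l)
  have h4 : (derivative^[m] (legendre l)).eval z = ((2 : ℝ) ^ l * (l.factorial : ℝ))⁻¹ *
      (derivative^[m] (derivative^[l] ((X ^ 2 - 1) ^ l : ℝ[X]))).eval z := by
    rw [legendre, iterate_derivative_C_mul, eval_C_mul]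
  rw [h4, ← h3]
  have h5 : (l.factorial : ℂ) ≠ 0 := by exact_mod_cast l.factorial_ne_zero
  push_cast
  simp only [Complex.ofRealHom_eq_coe]
  field_simp

theorem trinomialCoeff_zero_eq_legendre (l : ℕ) (z : ℝ) :
    trinomialCoeff l 0 z ((z : ℂ) ^ 2 - 1) = 2 ^ l * (((legendre l).eval z : ℝ) : ℂ) := by
  have h := trinomialCoeff_eq_legendre l 0 z
  have h5 : (l.factorial : ℂ) ≠ 0 := by exact_mod_cast l.factorial_ne_zero
  rw [add_zero, Function.iterate_zero, id] at h
  apply mul_left_cancel₀ h5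
  rw [h]
  ring

/-- Laplace's formula for Legendre polynomials, with a sum over roots of unity. -/
theorem sum_primitiveRoot_pow_eq_legendre (l : ℕ) {ζ : ℂ}
    (hζ : IsPrimitiveRoot ζ (2 * l + 1)) (a p q : ℂ) (z : ℝ) (h : p * q = a ^ 2 * (z ^ 2 - 1)) :
    ∑ j ∈ Finset.range (2 * l + 1), (a * z + (p * ζ ^ j + q * (ζ ^ j)⁻¹) / 2) ^ l =
      (2 * l + 1) * a ^ l * (((legendre l).eval z : ℝ) : ℂ) := by
  have h1 := sum_primitiveRoot_mul_pow l 0 (Nat.zero_le _) hζ (a * z) p q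
  simp only [pow_zero, one_mul, h, trinomialCoeff_zero_smul, trinomialCoeff_zero_eq_legendre] at h1
  rw [h1]
  field_simp


/-! ### Isometries of the Bloch sphere -/

/-- The action of a linear isometry on the Bloch sphere. -/
def act (g : E3 ≃ₗᵢ[ℝ] E3) (x : BlochSphere) : BlochSphere :=
  ⟨g x.1, by simp⟩

@[simp] theorem coe_act (g : E3 ≃ₗᵢ[ℝ] E3) (x : BlochSphere) : (act g x).1 = g x.1 := rfl

theorem continuous_act (g : E3 ≃ₗᵢ[ℝ] E3) : Continuous (act g) :=
  Continuous.subtype_mk (g.continuous.comp continuous_subtype_val) _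

instance : IsFiniteMeasure surfaceMeasure := by
  unfold surfaceMeasure; infer_instance

instance : surfaceMeasure.IsOpenPosMeasure := by
  unfold surfaceMeasure; infer_instance

-- The surface measure of `s` is a multiple of the volume of the cone `(0, 1) • s`, and a linear
-- isometry maps cones to cones and preserves volume.
open scoped Pointwise in
theorem measurePreserving_act (g : E3 ≃ₗᵢ[ℝ] E3) :
    MeasurePreserving (act g) surfaceMeasure surfaceMeasure := by
  refine ⟨(continuous_act g).measurable, ?_⟩
  ext s hs
  rw [Measure.map_apply (continuous_act g).measurable hs, surfaceMeasure,
    Measure.toSphere_apply' _ ((continuous_act g).measurable hs), Measure.toSphere_apply' _ hs]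
  congr 1
  have hB := (show MeasurePreserving g.toMeasurableEquiv volume volume from
    g.measurePreserving).measure_preimage_equiv (Set.Ioo (0 : ℝ) 1 • (Subtype.val '' s : Set E3))
  rw [← hB]
  congr 1
  ext y
  simp only [Set.mem_smul, Set.mem_image, Set.mem_preimage]
  constructor
  · rintro ⟨r, hr, _, ⟨x, hx, rfl⟩, rfl⟩
    exact ⟨r, hr, g x.1, ⟨act g x, hx, rfl⟩, (map_smul g r x.1).symm⟩
  · rintro ⟨r, hr, _, ⟨x, hx, rfl⟩, h⟩
    refine ⟨r, hr, g.symm x.1, ⟨act g.symm x, ?_, rfl⟩, ?_⟩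
    · have : act g (act g.symm x) = x := by ext1; simp
      rwa [this]
    · apply g.injective
      rw [map_smul, g.apply_symm_apply]
      exact h

theorem integral_act {E : Type*} [NormedAddCommGroup E] [NormedSpace ℝ E]
    (g : E3 ≃ₗᵢ[ℝ] E3) (f : BlochSphere → E) :
    ∫ x, f (act g x) ∂surfaceMeasure = ∫ x, f x ∂surfaceMeasure := by
  have hinj : Function.LeftInverse (act g.symm) (act g) := fun x => by ext1; simp
  have hinj2 : Function.RightInverse (act g.symm) (act g) := fun x => by ext1; simp
  let e : BlochSphere ≃ₜ BlochSphere :=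
    ⟨⟨act g, act g.symm, hinj, hinj2⟩, continuous_act _, continuous_act _⟩
  exact (measurePreserving_act g).integral_comp e.measurableEmbedding f

theorem integrable_of_continuous {f : BlochSphere → ℂ} (hf : Continuous f) :
    Integrable f surfaceMeasure :=
  hf.integrable_of_hasCompactSupport (HasCompactSupport.of_compactSpace f)

theorem sum_sq_coord (x : BlochSphere) : x.1 0 ^ 2 + x.1 1 ^ 2 + x.1 2 ^ 2 = 1 := by
  have h : ‖x.1‖ = 1 := by simp
  rw [EuclideanSpace.norm_eq, Real.sqrt_eq_one, Fin.sum_univ_three] at h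
  simpa using h

theorem sq_re_add_sq_im (c : Circle) : (c : ℂ).re ^ 2 + (c : ℂ).im ^ 2 = 1 := by
  have := c.normSq_coe
  rw [Complex.normSq_apply] at this
  linarith

/-- The linear isometry given by a norm-preserving linear map. -/
def isometryOfNorm (f : E3 →ₗ[ℝ] E3)
    (hf : ∀ x : E3, f x 0 ^ 2 + f x 1 ^ 2 + f x 2 ^ 2 = x 0 ^ 2 + x 1 ^ 2 + x 2 ^ 2) :
    E3 ≃ₗᵢ[ℝ] E3 :=
  LinearIsometry.toLinearIsometryEquiv ⟨f, fun x => by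
    rw [EuclideanSpace.norm_eq, EuclideanSpace.norm_eq, Fin.sum_univ_three, Fin.sum_univ_three]
    congr 1
    simpa using hf x⟩ rfl

@[simp] theorem isometryOfNorm_apply (f : E3 →ₗ[ℝ] E3) (hf) (x : E3) :
    isometryOfNorm f hf x = f x := rfl

/-- The rotation about the first axis. -/
def rotX (c : Circle) : E3 ≃ₗᵢ[ℝ] E3 :=
  isometryOfNorm
    { toFun := fun x => !₂[x 0, (c : ℂ).re * x 1 - (c : ℂ).im * x 2,
        (c : ℂ).im * x 1 + (c : ℂ).re * x 2]
      map_add' := fun x y => by ext i; fin_cases i <;> simp <;> ring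
      map_smul' := fun r x => by ext i; fin_cases i <;> simp <;> ring }
    (fun x => by
      simp
      linear_combination (x 1 ^ 2 + x 2 ^ 2) * sq_re_add_sq_im c)

/-- The rotation about the third axis. -/
def rotZ (c : Circle) : E3 ≃ₗᵢ[ℝ] E3 :=
  isometryOfNorm
    { toFun := fun x => !₂[(c : ℂ).re * x 0 - (c : ℂ).im * x 1,
        (c : ℂ).im * x 0 + (c : ℂ).re * x 1, x 2]
      map_add' := fun x y => by ext i; fin_cases i <;> simp <;> ring
      map_smul' := fun r x => by ext i; fin_cases i <;> simp <;> ring }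
    (fun x => by
      simp
      linear_combination (x 0 ^ 2 + x 1 ^ 2) * sq_re_add_sq_im c)

theorem rotX_apply (c : Circle) (x : E3) : rotX c x = !₂[x 0, (c : ℂ).re * x 1 - (c : ℂ).im * x 2,
    (c : ℂ).im * x 1 + (c : ℂ).re * x 2] := rfl

theorem rotZ_apply (c : Circle) (x : E3) : rotZ c x = !₂[(c : ℂ).re * x 0 - (c : ℂ).im * x 1,
    (c : ℂ).im * x 0 + (c : ℂ).re * x 1, x 2] := rfl

theorem rotX_mul (c d : Circle) (x : E3) : rotX (c * d) x = rotX c (rotX d x) := by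
  ext i
  fin_cases i <;> simp [rotX_apply] <;> ring

theorem rotZ_inv_rotZ (c : Circle) (x : E3) : rotZ c⁻¹ (rotZ c x) = x := by
  have h := sq_re_add_sq_im c
  ext i
  fin_cases i <;> simp [rotZ_apply]
  · linear_combination x 0 * h
  · linear_combination x 1 * h

theorem continuous_rotX_act :
    Continuous fun p : UnitAddCircle × BlochSphere => act (rotX p.1.toCircle) p.2 := by
  refine Continuous.subtype_mk ?_ _
  have h : Continuous fun p : UnitAddCircle × BlochSphere => ((p.1.toCircle : Circle) : ℂ) :=
    continuous_subtype_val.comp (AddCircle.continuous_toCircle.comp continuous_fst)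
  have h2 : Continuous fun p : UnitAddCircle × BlochSphere => p.2.1 :=
    continuous_subtype_val.comp continuous_snd
  simp only [rotX_apply]
  refine (PiLp.continuous_toLp 2 _).comp ?_
  refine continuous_pi fun i => ?_
  fin_cases i <;> simp <;> fun_prop

theorem continuous_comp_rotX_act {F : BlochSphere → ℂ} (hF : Continuous F) :
    Continuous fun p : BlochSphere × UnitAddCircle => F (act (rotX p.2.toCircle) p.1) := by
  have h := continuous_rotX_act.comp (continuous_snd.prodMk continuous_fst :
    Continuous fun p : BlochSphere × UnitAddCircle => (p.2, p.1))
  exact hF.comp h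

/-- A reflection does it; orientation plays no role, since balance and invariance are used for all
linear isometries. -/
theorem exists_act_eq (x y : BlochSphere) : ∃ g : E3 ≃ₗᵢ[ℝ] E3, act g x = y := by
  have h : ‖x.1‖ = ‖y.1‖ := by simp
  exact ⟨_, Subtype.ext (Submodule.reflection_sub h)⟩

/-! ### Zonal averages -/

/-- The average of a function over the rotations about the first axis. -/
def zonalAverage (F : BlochSphere → ℂ) (x : BlochSphere) : ℂ :=
  ∫ θ : UnitAddCircle, F (act (rotX θ.toCircle) x)

theorem continuous_zonalAverage {F : BlochSphere → ℂ} (hF : Continuous F) :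
    Continuous (zonalAverage F) := by
  have := continuous_parametric_integral_of_continuous (μ := (volume : Measure UnitAddCircle))
    (f := fun (x : BlochSphere) (θ : UnitAddCircle) => F (act (rotX θ.toCircle) x))
    (continuous_comp_rotX_act hF) isCompact_univ
  simp only [Measure.restrict_univ] at this
  exact this

theorem exists_rotX_act_eq {x y : BlochSphere} (h : x.1 0 = y.1 0) :
    ∃ c : Circle, act (rotX c) x = y := by
  have hx := sum_sq_coord x
  have hy := sum_sq_coord y
  by_cases hr : x.1 1 ^ 2 + x.1 2 ^ 2 = 0
  · have h1 : x.1 1 = 0 := by nlinarith [sq_nonneg (x.1 1), sq_nonneg (x.1 2)]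
    have h2 : x.1 2 = 0 := by nlinarith [sq_nonneg (x.1 1), sq_nonneg (x.1 2)]
    rw [h] at hx
    have h3 : y.1 1 = 0 := by nlinarith [sq_nonneg (y.1 1), sq_nonneg (y.1 2)]
    have h4 : y.1 2 = 0 := by nlinarith [sq_nonneg (y.1 1), sq_nonneg (y.1 2)]
    refine ⟨1, ?_⟩
    ext i
    fin_cases i <;> simp [rotX_apply, h, h1, h2, h3, h4]
  -- Away from the poles the rotation is the quotient of the transverse components, read as complex
  -- numbers of equal modulus.
  · have hw : (⟨x.1 1, x.1 2⟩ : ℂ) ≠ 0 := by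
      intro h0
      have h1 := congrArg Complex.re h0
      have h2 := congrArg Complex.im h0
      simp at h1 h2
      simp [h1, h2] at hr
    have hn : ‖(⟨y.1 1, y.1 2⟩ / ⟨x.1 1, x.1 2⟩ : ℂ)‖ = 1 := by
      rw [norm_div, div_eq_one_iff_eq (norm_ne_zero_iff.mpr hw), Complex.norm_def, Complex.norm_def]
      congr 1
      rw [Complex.normSq_mk, Complex.normSq_mk]
      rw [h] at hx
      linarith
    refine ⟨⟨_, mem_sphere_zero_iff_norm.mpr hn⟩, ?_⟩
    have hmul := div_mul_cancel₀ (⟨y.1 1, y.1 2⟩ : ℂ) hw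
    generalize (⟨y.1 1, y.1 2⟩ / ⟨x.1 1, x.1 2⟩ : ℂ) = c at hn hmul
    have h1 := congrArg Complex.re hmul
    have h2 := congrArg Complex.im hmul
    simp at h1 h2
    ext i
    fin_cases i
    · exact h
    · exact h1
    · exact (add_comm _ _).trans h2

theorem zonalAverage_act_rotX (F : BlochSphere → ℂ) (c : Circle) (x : BlochSphere) :
    zonalAverage F (act (rotX c) x) = zonalAverage F x := by
  obtain ⟨φ, rfl⟩ : ∃ φ : UnitAddCircle, φ.toCircle = c :=
    by
    obtain ⟨φ, hφ⟩ := (AddCircle.homeomorphCircle one_ne_zero).surjective c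
    exact ⟨φ, by rw [← hφ, AddCircle.homeomorphCircle_apply]⟩
  rw [zonalAverage, zonalAverage,
    ← integral_add_right_eq_self (fun θ : UnitAddCircle => F (act (rotX θ.toCircle) x)) φ]
  congr 1
  ext θ
  congr 1
  ext1
  rw [coe_act, coe_act, coe_act, AddCircle.toCircle_add, rotX_mul]

theorem zonalAverage_congr (F : BlochSphere → ℂ) {x y : BlochSphere} (h : x.1 0 = y.1 0) :
    zonalAverage F x = zonalAverage F y := by
  obtain ⟨c, rfl⟩ := exists_rotX_act_eq h
  rw [zonalAverage_act_rotX]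

/-- Fubini and rotation invariance of the surface measure; no factor appears because the circle has
total mass 1. -/
theorem integral_zonalAverage_mul {F k : BlochSphere → ℂ} (hF : Continuous F) (hk : Continuous k)
    (hinv : ∀ c x, k (act (rotX c) x) = k x) :
    ∫ x, zonalAverage F x * k x ∂surfaceMeasure = ∫ x, F x * k x ∂surfaceMeasure := by
  have h1 : ∀ x, zonalAverage F x * k x = ∫ θ : UnitAddCircle,
      F (act (rotX θ.toCircle) x) * k (act (rotX θ.toCircle) x) := by
    intro x
    simp only [hinv]
    rw [integral_mul_const, zonalAverage]
  simp only [h1]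
  rw [integral_integral_swap]
  · simp only [integral_act _ fun x => F x * k x]
    simp [measureReal_def]
  · have := continuous_comp_rotX_act (hF.mul hk)
    exact this.integrable_of_hasCompactSupport (HasCompactSupport.of_compactSpace _)


/-! ### Power sums over regular polygons -/

/-- After binomial expansion the sum over `j` is geometric with ratio `ζ ^ (2 i - k)`, and vanishes
unless that ratio is 1. -/
theorem sum_primitiveRoot_add_inv_pow {N : ℕ} (hN : N ≠ 0) {ζ : ℂ} (hζ : IsPrimitiveRoot ζ N)
    (p q : ℂ) (k : ℕ) :
    ∑ j ∈ Finset.range N, (p * ζ ^ j + q * (ζ ^ j)⁻¹) ^ k =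
      N * ∑ i ∈ Finset.range (k + 1),
        if i ≡ k - i [MOD N] then (k.choose i : ℂ) * p ^ i * q ^ (k - i) else 0 := by
  have hζ0 : ζ ≠ 0 := hζ.ne_zero hN
  simp only [add_pow]
  rw [Finset.sum_comm, Finset.mul_sum]
  refine Finset.sum_congr rfl fun i _ => ?_
  have h1 : ∀ j ∈ Finset.range N, (p * ζ ^ j) ^ i * (q * (ζ ^ j)⁻¹) ^ (k - i) * (k.choose i : ℂ) =
      (k.choose i : ℂ) * p ^ i * q ^ (k - i) * (ζ ^ i * (ζ ^ (k - i))⁻¹) ^ j := by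
    intro j _
    rw [mul_pow, mul_pow, mul_pow, inv_pow, inv_pow, ← pow_mul, ← pow_mul, ← pow_mul, ← pow_mul,
      mul_comm j i, mul_comm j (k - i)]
    ring
  rw [Finset.sum_congr rfl h1, ← Finset.mul_sum]
  have hki := pow_ne_zero (k - i) hζ0
  have hiff : ζ ^ i * (ζ ^ (k - i))⁻¹ = 1 ↔ i ≡ k - i [MOD N] := by
    rw [mul_inv_eq_one₀ hki]
    have := (hζ.isUnit hN)
    obtain ⟨u, rfl⟩ := this
    rw [← Units.val_pow_eq_pow_val, ← Units.val_pow_eq_pow_val, Units.val_inj,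
      pow_eq_pow_iff_modEq, ← (IsPrimitiveRoot.coe_units_iff.mp hζ).eq_orderOf]
  split_ifs with h
  · rw [hiff.mpr h]
    simp
    ring
  · have hpow : (ζ ^ i * (ζ ^ (k - i))⁻¹) ^ N = 1 := by
      rw [mul_pow, inv_pow, ← pow_mul, ← pow_mul, mul_comm i, mul_comm (k - i), pow_mul, pow_mul,
        hζ.pow_eq_one]
      simp
    rw [geom_sum_eq (fun h' => h (hiff.mp h')), hpow]
    simp

theorem cos_add_sin_eq_primitiveRoot (N j : ℕ) (a b : ℝ) :
    ((a * Real.cos (2 * Real.pi * j / N) + b * Real.sin (2 * Real.pi * j / N) : ℝ) : ℂ) =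
      (a - b * Complex.I) / 2 * Complex.exp (2 * Real.pi * Complex.I / N) ^ j +
      (a + b * Complex.I) / 2 * (Complex.exp (2 * Real.pi * Complex.I / N) ^ j)⁻¹ := by
  rw [← Complex.exp_nat_mul, ← Complex.exp_neg]
  have h1 : (j : ℂ) * (2 * Real.pi * Complex.I / N) =
      ((2 * Real.pi * j / N : ℝ) : ℂ) * Complex.I := by
    push_cast; ring
  rw [h1]
  generalize (2 * Real.pi * j / N : ℝ) = t
  rw [← neg_mul, ← Complex.ofReal_neg, Complex.exp_mul_I, Complex.exp_mul_I]
  push_cast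
  rw [Complex.cos_neg, Complex.sin_neg]
  linear_combination (b * Complex.sin t) * Complex.I_sq

/-- No term survives: `i` and `k - i` have opposite parity, which excludes a congruence modulo an
even `N`; if `k < N`, both are below `N` and the congruence would force them to be equal. -/
theorem sum_cos_sin_pow_eq_zero {N k : ℕ} (hk : Odd k) (h : Even N ∨ k < N) (hN : N ≠ 0)
    (a b : ℝ) :
    ∑ j ∈ Finset.range N,
      (a * Real.cos (2 * Real.pi * j / N) + b * Real.sin (2 * Real.pi * j / N)) ^ k = 0 := by
  rw [← Complex.ofReal_inj]
  simp only [Complex.ofReal_sum, Complex.ofReal_pow, cos_add_sin_eq_primitiveRoot]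
  rw [sum_primitiveRoot_add_inv_pow hN (Complex.isPrimitiveRoot_exp N hN),
    Finset.sum_eq_zero, mul_zero, Complex.ofReal_zero]
  intro i hi
  rw [Finset.mem_range] at hi
  refine if_neg fun hmod => ?_
  obtain ⟨c, rfl⟩ := hk
  rcases h with ⟨d, rfl⟩ | h
  · have : i ≡ 2 * c + 1 - i [MOD 2] := hmod.of_dvd ⟨d, by ring⟩
    unfold Nat.ModEq at this
    omega
  · have := Nat.ModEq.eq_of_lt_of_lt hmod (by omega) (by omega)
    omega

/-- With `p = q = 1 / 2` every surviving term is positive, so one of them is enough. -/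
theorem sum_cos_pow_ne_zero {N l i : ℕ} (hN : N ≠ 0) (hi : i ≤ l) (hmod : i ≡ l - i [MOD N]) :
    ∑ j ∈ Finset.range N, Real.cos (2 * Real.pi * j / N) ^ l ≠ 0 := by
  have h : ((∑ j ∈ Finset.range N, Real.cos (2 * Real.pi * j / N) ^ l : ℝ) : ℂ) =
      ((N * ∑ i ∈ Finset.range (l + 1), if i ≡ l - i [MOD N] then
        (l.choose i : ℝ) * (1 / 2) ^ i * (1 / 2) ^ (l - i) else 0 : ℝ) : ℂ) := by
    have h1 := sum_primitiveRoot_add_inv_pow hN (Complex.isPrimitiveRoot_exp N hN) (1 / 2) (1 / 2) l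
    have h2 := fun j => cos_add_sin_eq_primitiveRoot N j 1 0
    simp only [one_mul, zero_mul, add_zero, Complex.ofReal_one, Complex.ofReal_zero, sub_zero] at h2
    simp only [Complex.ofReal_sum, Complex.ofReal_pow, h2, h1]
    push_cast
    congr 1
    refine Finset.sum_congr rfl fun i _ => ?_
    split_ifs <;> simp
  rw [Complex.ofReal_inj.mp h]
  refine mul_ne_zero (Nat.cast_ne_zero.mpr hN) (ne_of_gt ?_)
  refine Finset.sum_pos' (fun _ _ => by split_ifs <;> positivity) ⟨i, ?_, ?_⟩
  · rw [Finset.mem_range]; omega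
  · rw [if_pos hmod]
    have := Nat.choose_pos hi
    positivity

/-! ### Balanced functions -/

/-- The vertices of the regular polygon in the equatorial plane. -/
def polygonVertex (N j : ℕ) : BlochSphere :=
  ⟨!₂[Real.cos (2 * Real.pi * j / N), Real.sin (2 * Real.pi * j / N), 0], by
    rw [mem_sphere_zero_iff_norm, EuclideanSpace.norm_eq, Real.sqrt_eq_one, Fin.sum_univ_three]
    simp⟩

/-- The sum of the function over every regular `N`-gon on a great circle vanishes. -/
def IsBalanced (N : ℕ) (F : BlochSphere → ℂ) : Prop :=
  ∀ g : E3 ≃ₗᵢ[ℝ] E3, ∑ j ∈ Finset.range N, F (act g (polygonVertex N j)) = 0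

theorem IsBalanced.comp_act {N : ℕ} {F : BlochSphere → ℂ} (h : IsBalanced N F)
    (g : E3 ≃ₗᵢ[ℝ] E3) : IsBalanced N (fun x => F (act g x)) :=
  fun g' => h (g'.trans g)

/-- The first coordinate vector. -/
def axisX : BlochSphere := ⟨EuclideanSpace.single 0 1, by simp⟩

theorem inner_eq_sum (x y : E3) : inner ℝ x y = x 0 * y 0 + x 1 * y 1 + x 2 * y 2 := by
  simp [PiLp.inner_apply, Fin.sum_univ_three]
  ring

theorem inner_axisX (x : E3) : inner ℝ x axisX.1 = x 0 := by
  simp [inner_eq_sum, axisX]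

/-- The element of the unit circle with argument `2 π j / N`. -/
def polygonAngle (N j : ℕ) : Circle := Circle.exp (2 * Real.pi * j / N)

theorem re_polygonAngle (N j : ℕ) :
    (polygonAngle N j : ℂ).re = Real.cos (2 * Real.pi * j / N) := by
  rw [polygonAngle, Circle.coe_exp, Complex.exp_ofReal_mul_I_re]

theorem im_polygonAngle (N j : ℕ) :
    (polygonAngle N j : ℂ).im = Real.sin (2 * Real.pi * j / N) := by
  rw [polygonAngle, Circle.coe_exp, Complex.exp_ofReal_mul_I_im]

/-- The zonal average sees only the first coordinate. That of the rotated `x` is the inner product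
of `x` with the vertex `j`, which is also the first coordinate of `g` applied to that vertex when
`g` takes `x` to the first axis. Balance then applies to each rotated copy of one polygon. -/
theorem IsBalanced.sum_zonalAverage {N : ℕ} {F : BlochSphere → ℂ} (h : IsBalanced N F)
    (hF : Continuous F) (x : BlochSphere) :
    ∑ j ∈ Finset.range N, zonalAverage F (act (rotZ (polygonAngle N j)⁻¹) x) = 0 := by
  obtain ⟨g, hg⟩ := exists_act_eq x axisX
  have h1 : ∀ j ∈ Finset.range N, zonalAverage F (act (rotZ (polygonAngle N j)⁻¹) x) =
      zonalAverage F (act g (polygonVertex N j)) := by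
    intro j _
    apply zonalAverage_congr
    have h2 : (act g (polygonVertex N j)).1 0 = inner ℝ (polygonVertex N j).1 x.1 := by
      rw [← inner_axisX, ← hg, coe_act, coe_act, LinearIsometryEquiv.inner_map_map]
    rw [h2, inner_eq_sum, coe_act, rotZ_apply]
    simp [polygonVertex, re_polygonAngle, im_polygonAngle]
  rw [Finset.sum_congr rfl h1]
  simp only [zonalAverage]
  rw [← integral_finsetSum]
  · have h3 : ∀ θ : UnitAddCircle, ∑ j ∈ Finset.range N,
        F (act (rotX θ.toCircle) (act g (polygonVertex N j))) = 0 := fun θ =>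
      h (g.trans (rotX θ.toCircle))
    simp [h3]
  · intro j _
    have := (continuous_comp_rotX_act hF).comp
      (Continuous.prodMk_right (act g (polygonVertex N j)) (Y := UnitAddCircle))
    exact this.integrable_of_hasCompactSupport (HasCompactSupport.of_compactSpace _)

/-- The complex linear form on the Bloch sphere with coefficients `a`. -/
def dotC (a : Fin 3 → ℂ) (x : BlochSphere) : ℂ :=
  a 0 * x.1 0 + a 1 * x.1 1 + a 2 * x.1 2

theorem sum_sq_coord_complex (x : BlochSphere) :
    (x.1 0 : ℂ) ^ 2 + (x.1 1 : ℂ) ^ 2 + (x.1 2 : ℂ) ^ 2 = 1 := by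
  have h := congrArg Complex.ofReal (sum_sq_coord x)
  push_cast at h
  exact h

theorem continuous_coord (i : Fin 3) : Continuous fun x : BlochSphere => x.1 i := by
  fun_prop

theorem continuous_dotC (a : Fin 3 → ℂ) : Continuous (dotC a) := by
  unfold dotC
  have := fun i => Complex.continuous_ofReal.comp (continuous_coord i)
  exact ((continuous_const.mul (this 0)).add (continuous_const.mul (this 1))).add
    (continuous_const.mul (this 2))

theorem continuous_legendre_coord (l : ℕ) (i : Fin 3) :
    Continuous fun x : BlochSphere => (((legendre l).eval (x.1 i) : ℝ) : ℂ) :=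
  Complex.continuous_ofReal.comp ((legendre l).continuous.comp (continuous_coord i))

theorem inv_circle_eq (c : Circle) : ((c : ℂ))⁻¹ = (c : ℂ).re - (c : ℂ).im * Complex.I := by
  rw [← Circle.coe_inv, Circle.coe_inv_eq_conj]
  apply Complex.ext <;> simp

theorem dotC_act_rotX (a : Fin 3 → ℂ) (c : Circle) (x : BlochSphere) :
    dotC a (act (rotX c) x) = a 0 * x.1 0 +
      ((a 1 - a 2 * Complex.I) * (x.1 1 + x.1 2 * Complex.I) * c +
        (a 1 + a 2 * Complex.I) * (x.1 1 - x.1 2 * Complex.I) * (c : ℂ)⁻¹) / 2 := by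
  rw [dotC, coe_act, rotX_apply, inv_circle_eq]
  have hc := (Complex.re_add_im (c : ℂ)).symm
  generalize (c : ℂ).re = u at *
  generalize (c : ℂ).im = v at *
  rw [hc]
  simp
  linear_combination (a 2 * x.1 1 * v + a 2 * x.1 2 * u - a 1 * x.1 2 * v) * Complex.I_sq

/-- Rotating about the first axis leaves the integral unchanged, so the power may be replaced by its
mean over `2 l + 1` rotations. Isotropy of `a` is what makes that mean `a 0 ^ l * P_l(x 0)` by
Laplace's formula. -/
theorem integral_zonalAverage_mul_dotC_pow {F : BlochSphere → ℂ} (hF : Continuous F) (l : ℕ)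
    {a : Fin 3 → ℂ} (ha : a 0 ^ 2 + a 1 ^ 2 + a 2 ^ 2 = 0) :
    ∫ x, zonalAverage F x * dotC a x ^ l ∂surfaceMeasure =
      a 0 ^ l * ∫ x, zonalAverage F x * (((legendre l).eval (x.1 0) : ℝ) : ℂ) ∂surfaceMeasure := by
  have hM : 2 * l + 1 ≠ 0 := by omega
  have hζ := Complex.isPrimitiveRoot_exp (2 * l + 1) hM
  generalize Complex.exp (2 * Real.pi * Complex.I / (2 * l + 1 : ℕ)) = ζ at hζ
  have hn : ‖ζ‖ = 1 := hζ.norm'_eq_one hM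
  obtain ⟨c, rfl⟩ : ∃ c : Circle, (c : ℂ) = ζ := ⟨⟨ζ, mem_sphere_zero_iff_norm.mpr hn⟩, rfl⟩
  have hG := continuous_zonalAverage hF
  have h1 : ∀ j : ℕ, ∫ x, zonalAverage F x * dotC a (act (rotX (c ^ j)) x) ^ l ∂surfaceMeasure =
      ∫ x, zonalAverage F x * dotC a x ^ l ∂surfaceMeasure := by
    intro j
    rw [← integral_act (rotX (c ^ j)) fun x => zonalAverage F x * dotC a x ^ l]
    simp only [zonalAverage_act_rotX]
  have h2 : ∀ x : BlochSphere,
      ∑ j ∈ Finset.range (2 * l + 1), dotC a (act (rotX (c ^ j)) x) ^ l =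
        (2 * l + 1) * a 0 ^ l * (((legendre l).eval (x.1 0) : ℝ) : ℂ) := by
    intro x
    rw [← sum_primitiveRoot_pow_eq_legendre l hζ (a 0)
      ((a 1 - a 2 * Complex.I) * (x.1 1 + x.1 2 * Complex.I))
      ((a 1 + a 2 * Complex.I) * (x.1 1 - x.1 2 * Complex.I))]
    · simp only [dotC_act_rotX, Circle.coe_pow]
    · have hx : (x.1 0 : ℂ) ^ 2 + (x.1 1 : ℂ) ^ 2 + (x.1 2 : ℂ) ^ 2 = 1 := sum_sq_coord_complex x
      linear_combination (a 2 ^ 2 * (x.1 2 : ℂ) ^ 2 * (Complex.I ^ 2 - 1) -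
        a 2 ^ 2 * (x.1 1 : ℂ) ^ 2 - a 1 ^ 2 * (x.1 2 : ℂ) ^ 2) * Complex.I_sq +
        ((x.1 1 : ℂ) ^ 2 + (x.1 2 : ℂ) ^ 2) * ha - a 0 ^ 2 * hx
  have h3 : ∑ j ∈ Finset.range (2 * l + 1),
      ∫ x, zonalAverage F x * dotC a (act (rotX (c ^ j)) x) ^ l ∂surfaceMeasure =
      (2 * l + 1) * a 0 ^ l *
        ∫ x, zonalAverage F x * (((legendre l).eval (x.1 0) : ℝ) : ℂ) ∂surfaceMeasure := by
    rw [← integral_finsetSum]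
    · simp only [← Finset.mul_sum, h2]
      rw [← integral_const_mul]
      congr 1
      ext x
      ring
    · intro j _
      exact integrable_of_continuous
        (hG.mul (((continuous_dotC a).comp (continuous_act _)).pow l))
  simp only [h1, Finset.sum_const, Finset.card_range, nsmul_eq_mul] at h3
  have h4 : (2 * (l : ℂ) + 1) ≠ 0 := by exact_mod_cast hM
  push_cast at h3
  rw [mul_assoc] at h3
  exact mul_left_cancel₀ h4 h3

/-- The Funk–Hecke step: the balance relation, integrated against one isotropic power, factors as
the cosine power sum times the integral in question. -/
theorem IsBalanced.integral_mul_legendre_axis {N l : ℕ} {F : BlochSphere → ℂ}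
    (h : IsBalanced N F) (hF : Continuous F)
    (hl : ∑ j ∈ Finset.range N, Real.cos (2 * Real.pi * j / N) ^ l ≠ 0) :
    ∫ x, F x * (((legendre l).eval (x.1 0) : ℝ) : ℂ) ∂surfaceMeasure = 0 := by
  rw [← integral_zonalAverage_mul hF (continuous_legendre_coord l 0) (fun c x => rfl)]
  have hG := continuous_zonalAverage hF
  -- The isotropic vector `(1, 0, i)` carried along by the rotation about the third axis; its first
  -- entry produces the cosine.
  let a : ℕ → Fin 3 → ℂ := fun j => ![Real.cos (2 * Real.pi * j / N),
    -Real.sin (2 * Real.pi * j / N), Complex.I]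
  have ha : ∀ j, a j 0 ^ 2 + a j 1 ^ 2 + a j 2 ^ 2 = 0 := by
    intro j
    have : (Real.cos (2 * Real.pi * j / N) : ℂ) ^ 2 +
        (Real.sin (2 * Real.pi * j / N) : ℂ) ^ 2 = 1 := by
      exact_mod_cast Real.cos_sq_add_sin_sq _
    simp only [a, Matrix.cons_val]
    linear_combination this + Complex.I_sq
  have h1 : ∀ j, ∫ x, zonalAverage F (act (rotZ (polygonAngle N j)⁻¹) x) *
      dotC ![1, 0, Complex.I] x ^ l ∂surfaceMeasure =
      ∫ x, zonalAverage F x * dotC (a j) x ^ l ∂surfaceMeasure := by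
    intro j
    rw [← integral_act (rotZ (polygonAngle N j)) fun x =>
      zonalAverage F (act (rotZ (polygonAngle N j)⁻¹) x) * dotC ![1, 0, Complex.I] x ^ l]
    congr 1
    ext x
    have h2 : act (rotZ (polygonAngle N j)⁻¹) (act (rotZ (polygonAngle N j)) x) = x := by
      ext1
      exact rotZ_inv_rotZ _ _
    rw [h2]
    congr 2
    simp [dotC, rotZ_apply, a, re_polygonAngle, im_polygonAngle]
    ring
  have h3 : ∑ j ∈ Finset.range N, ∫ x, zonalAverage F (act (rotZ (polygonAngle N j)⁻¹) x) *
      dotC ![1, 0, Complex.I] x ^ l ∂surfaceMeasure = 0 := by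
    rw [← integral_finsetSum]
    · simp only [← Finset.sum_mul, h.sum_zonalAverage hF]
      simp
    · intro j _
      exact integrable_of_continuous ((hG.comp (continuous_act _)).mul ((continuous_dotC _).pow l))
  simp only [h1, integral_zonalAverage_mul_dotC_pow hF l (ha _), ← Finset.sum_mul] at h3
  refine (mul_eq_zero.mp h3).resolve_left ?_
  simp only [a, Matrix.cons_val]
  exact_mod_cast hl

theorem IsBalanced.integral_mul_legendre {N l : ℕ} {F : BlochSphere → ℂ}
    (h : IsBalanced N F) (hF : Continuous F)
    (hl : ∑ j ∈ Finset.range N, Real.cos (2 * Real.pi * j / N) ^ l ≠ 0) (e : BlochSphere) :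
    ∫ x, F x * (((legendre l).eval (inner ℝ x.1 e.1) : ℝ) : ℂ) ∂surfaceMeasure = 0 := by
  obtain ⟨g, rfl⟩ := exists_act_eq axisX e
  rw [← integral_act g]
  have := (h.comp_act g).integral_mul_legendre_axis (hF.comp (continuous_act g)) hl
  simp only [coe_act, LinearIsometryEquiv.inner_map_map, inner_axisX]
  exact this


/-! ### From zonal functions to spherical harmonics -/

open Polynomial in
/-- A weighted evaluation at real nodes reproduces, for all `s` and `t`, the value at `τ = I` of
the polynomial `trinomialCoeff l 0 (s + t τ) ((s + t τ) ^ 2 - (1 + τ ^ 2))` in `τ`. -/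
theorem exists_interpolation (l : ℕ) : ∃ w : ℕ → ℂ, ∀ s t : ℂ,
    trinomialCoeff l 0 (s + t * Complex.I) ((s + t * Complex.I) ^ 2) =
      ∑ j ∈ Finset.range (l + 1),
        w j * trinomialCoeff l 0 (s + t * j) ((s + t * j) ^ 2 - (1 + (j : ℂ) ^ 2)) := by
  refine ⟨fun j => (Lagrange.basis (Finset.range (l + 1)) (fun j : ℕ => (j : ℂ)) j).eval Complex.I,
    fun s t => ?_⟩
  let Q : ℂ[X] := ∑ n ∈ Finset.range (l + 1), C (l.choose n : ℂ) *
    (C 2 * (C t * X + C s)) ^ (l - n) * (if 0 ≤ n ∧ 2 ∣ n - 0 then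
      C (n.choose ((n - 0) / 2) : ℂ) * ((C t * X + C s) ^ 2 - (1 + X ^ 2)) ^ ((n - 0) / 2) else 0)
  have hQ : ∀ τ, Q.eval τ = trinomialCoeff l 0 (s + t * τ) ((s + t * τ) ^ 2 - (1 + τ ^ 2)) := by
    intro τ
    rw [eval_finsetSum, trinomialCoeff]
    refine Finset.sum_congr rfl fun n _ => ?_
    rw [eval_mul, apply_ite (eval τ)]
    simp [add_comm s]
  have hlin : (C t * X + C s).natDegree ≤ 1 := natDegree_linear_le
  have hquad : ((C t * X + C s) ^ 2 - (1 + X ^ 2)).natDegree ≤ 2 := by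
    have h1 : (1 + X ^ 2 : ℂ[X]).natDegree ≤ 2 := by compute_degree
    exact (natDegree_sub_le_of_le (natDegree_pow_le_of_le 2 hlin) h1).trans (by simp)
  -- The nonzero terms have `n` even, so their degree is at most `(l - n) + 2 (n / 2) = l`, and `l +
  -- 1` nodes determine `Q`.
  have hdeg : Q.natDegree ≤ l := by
    refine natDegree_sum_le_of_forall_le _ _ fun n hn => ?_
    rw [Finset.mem_range] at hn
    split_ifs with h
    · have h1 : (C (l.choose n : ℂ) * (C 2 * (C t * X + C s)) ^ (l - n)).natDegree ≤ (l - n) * 1 :=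
        (natDegree_C_mul_le _ _).trans
          (natDegree_pow_le_of_le _ ((natDegree_C_mul_le _ _).trans hlin))
      have h2 : (C (n.choose ((n - 0) / 2) : ℂ) *
          ((C t * X + C s) ^ 2 - (1 + X ^ 2)) ^ ((n - 0) / 2)).natDegree ≤ (n - 0) / 2 * 2 :=
        (natDegree_C_mul_le _ _).trans (natDegree_pow_le_of_le _ hquad)
      refine (natDegree_mul_le_of_le h1 h2).trans ?_
      omega
    · simp
  have hdeg' : Q.degree < (Finset.range (l + 1)).card := by
    rw [Finset.card_range]
    exact (degree_le_of_natDegree_le hdeg).trans_lt (by exact_mod_cast Nat.lt_succ_self l)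
  have hinj : Set.InjOn (fun j : ℕ => (j : ℂ)) (Finset.range (l + 1)) :=
    Nat.cast_injective.injOn
  have h := congrArg (eval Complex.I) (Lagrange.eq_interpolate hinj hdeg')
  rw [Lagrange.interpolate_apply, hQ, eval_finsetSum] at h
  simp only [Complex.I_sq, add_neg_cancel, sub_zero, eval_mul, eval_C, hQ] at h
  rw [h]
  exact Finset.sum_congr rfl fun j _ => mul_comm _ _

theorem continuous_legendre_inner (l : ℕ) (e : E3) :
    Continuous fun x : BlochSphere => (((legendre l).eval (inner ℝ x.1 e) : ℝ) : ℂ) :=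
  Complex.continuous_ofReal.comp ((legendre l).continuous.comp (by fun_prop))

/-- If `F` is orthogonal to all zonal harmonics of degree `l`, it is orthogonal to the `l`-th powers
of the linear forms with isotropic coefficients. -/
theorem integral_mul_isotropic_pow {F : BlochSphere → ℂ} (hF : Continuous F) {l : ℕ}
    (h : ∀ e : BlochSphere,
      ∫ x, F x * (((legendre l).eval (inner ℝ x.1 e.1) : ℝ) : ℂ) ∂surfaceMeasure = 0)
    {u v : E3} (hu : ‖u‖ = 1) (hv : ‖v‖ = 1) (huv : inner ℝ u v = 0) :
    ∫ x, F x * ((inner ℝ x.1 u : ℝ) + (inner ℝ x.1 v : ℝ) * Complex.I) ^ l ∂surfaceMeasure = 0 := by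
  obtain ⟨w, hw⟩ := exists_interpolation l
  have hρ : ∀ j : ℕ, 0 < 1 + (j : ℝ) ^ 2 := fun j => by positivity
  have he : ∀ j : ℕ, ‖(√(1 + (j : ℝ) ^ 2))⁻¹ • (u + (j : ℝ) • v)‖ = 1 := by
    intro j
    have h1 : ‖u + (j : ℝ) • v‖ ^ 2 = 1 + (j : ℝ) ^ 2 := by
      rw [norm_add_sq_real, inner_smul_right, huv, norm_smul, hu, hv]
      simp
    rw [norm_smul, ← Real.sqrt_sq (norm_nonneg (u + (j : ℝ) • v)), h1, norm_inv, Real.norm_eq_abs,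
      abs_of_nonneg (Real.sqrt_nonneg _)]
    exact inv_mul_cancel₀ (Real.sqrt_ne_zero'.mpr (hρ j))
  -- The node `τ = j` gives the direction of `u + j v`, of squared length `1 + j ^ 2`; at `τ = i`
  -- this length degenerates to 0 and only a multiple of the isotropic power is left.
  let e : ℕ → BlochSphere := fun j => ⟨_, mem_sphere_zero_iff_norm.mpr (he j)⟩
  have h1 : ∀ (j : ℕ) (x : BlochSphere),
      trinomialCoeff l 0 ((inner ℝ x.1 u : ℝ) + (inner ℝ x.1 v : ℝ) * j)
        (((inner ℝ x.1 u : ℝ) + (inner ℝ x.1 v : ℝ) * j) ^ 2 - (1 + (j : ℂ) ^ 2)) =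
      (√(1 + (j : ℝ) ^ 2) : ℂ) ^ l * 2 ^ l *
        (((legendre l).eval (inner ℝ x.1 (e j).1) : ℝ) : ℂ) := by
    intro j x
    have h2 : √(1 + (j : ℝ) ^ 2) * inner ℝ x.1 (e j).1 = inner ℝ x.1 u + inner ℝ x.1 v * j := by
      simp only [e]
      rw [inner_smul_right, inner_add_right, inner_smul_right, mul_inv_cancel_left₀
        (Real.sqrt_ne_zero'.mpr (hρ j))]
      ring
    have h3 : (√(1 + (j : ℝ) ^ 2) : ℂ) ^ 2 = 1 + (j : ℂ) ^ 2 := by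
      have := congrArg Complex.ofReal (Real.sq_sqrt (hρ j).le)
      push_cast at this
      exact this
    have h4 := congrArg Complex.ofReal h2
    push_cast at h4
    rw [mul_assoc, ← trinomialCoeff_zero_eq_legendre, ← trinomialCoeff_zero_smul, ← h4]
    congr 1
    rw [mul_sub, mul_pow, h3, mul_one]
  have h5 : ∀ x : BlochSphere, trinomialCoeff l 0 1 1 *
      (F x * ((inner ℝ x.1 u : ℝ) + (inner ℝ x.1 v : ℝ) * Complex.I) ^ l) =
      ∑ j ∈ Finset.range (l + 1), w j * ((√(1 + (j : ℝ) ^ 2) : ℂ) ^ l * 2 ^ l) *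
        (F x * (((legendre l).eval (inner ℝ x.1 (e j).1) : ℝ) : ℂ)) := by
    intro x
    have h6 := hw (inner ℝ x.1 u : ℝ) (inner ℝ x.1 v : ℝ)
    have h7 := trinomialCoeff_zero_smul l
      ((inner ℝ x.1 u : ℝ) + (inner ℝ x.1 v : ℝ) * Complex.I) 1 1
    rw [mul_one, mul_one] at h7
    rw [h7] at h6
    rw [mul_left_comm, mul_comm (trinomialCoeff l 0 1 1), h6, Finset.mul_sum]
    refine Finset.sum_congr rfl fun j _ => ?_
    rw [h1]
    ring
  have h8 := congrArg (fun f : BlochSphere → ℂ => ∫ x, f x ∂surfaceMeasure) (funext h5)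
  rw [integral_const_mul, integral_finsetSum] at h8
  · simp only [integral_const_mul, h, mul_zero, Finset.sum_const_zero] at h8
    exact (mul_eq_zero.mp h8).resolve_left (trinomialCoeff_zero_one_one_ne_zero l)
  · intro j _
    exact (integrable_of_continuous (hF.mul (continuous_legendre_inner l _))).const_mul _

theorem continuous_inner_complex (u : E3) :
    Continuous fun x : BlochSphere => ((inner ℝ x.1 u : ℝ) : ℂ) :=
  Complex.continuous_ofReal.comp (by fun_prop)

/-- `Y_{lm}` is, up to a constant, the Fourier coefficient `m` of the isotropic powers obtained by
turning `v` in the equatorial plane, with `u` the third axis. -/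
theorem integral_mul_sphericalHarmonicNat {F : BlochSphere → ℂ} (hF : Continuous F) {l m : ℕ}
    (hm : m ≤ l) (h : ∀ e : BlochSphere,
      ∫ x, F x * (((legendre l).eval (inner ℝ x.1 e.1) : ℝ) : ℂ) ∂surfaceMeasure = 0) :
    ∫ x, F x * sphericalHarmonicNat l m x ∂surfaceMeasure = 0 := by
  have hM : 2 * l + 1 ≠ 0 := by omega
  have hζ := Complex.isPrimitiveRoot_exp (2 * l + 1) hM
  generalize Complex.exp (2 * Real.pi * Complex.I / (2 * l + 1 : ℕ)) = ζ at hζ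
  have hn : ‖ζ‖ = 1 := hζ.norm'_eq_one hM
  obtain ⟨c, rfl⟩ : ∃ c : Circle, (c : ℂ) = ζ := ⟨⟨ζ, mem_sphere_zero_iff_norm.mpr hn⟩, rfl⟩
  let u : E3 := EuclideanSpace.single 2 1
  -- Chosen so that `i (x · v j)` equals `(p ζ ^ j + q ζ ^ (-j)) / 2` with `p = x 0 + i x 1` and `q
  -- = -(x 0 - i x 1)`.
  let v : ℕ → E3 := fun j => !₂[((c ^ j : Circle) : ℂ).im, ((c ^ j : Circle) : ℂ).re, 0]
  have hu : ‖u‖ = 1 := by simp [u]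
  have hv : ∀ j, ‖v j‖ = 1 := by
    intro j
    rw [EuclideanSpace.norm_eq, Real.sqrt_eq_one, Fin.sum_univ_three]
    have := sq_re_add_sq_im (c ^ j)
    simp [v] at this ⊢
    linarith
  have huv : ∀ j, inner ℝ u (v j) = 0 := by
    intro j
    simp [inner_eq_sum, u, v]
  have h1 : ∀ x : BlochSphere, ∑ j ∈ Finset.range (2 * l + 1), (((c : ℂ) ^ j)⁻¹) ^ m *
      (((inner ℝ x.1 u : ℝ) + (inner ℝ x.1 (v j) : ℝ) * Complex.I) ^ l) =
      (2 * l + 1) * (2 ^ l)⁻¹ * ((x.1 0 + Complex.I * x.1 1) ^ m *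
        trinomialCoeff l m (x.1 2) ((x.1 2 : ℂ) ^ 2 - 1)) := by
    intro x
    have hx : ((x.1 0 : ℂ) + Complex.I * x.1 1) * (-(x.1 0 - Complex.I * x.1 1)) =
        (x.1 2 : ℂ) ^ 2 - 1 := by
      linear_combination (-1 : ℂ) * sum_sq_coord_complex x + (x.1 1 : ℂ) ^ 2 * Complex.I_sq
    rw [← hx, ← sum_primitiveRoot_mul_pow l m hm hζ]
    refine Finset.sum_congr rfl fun j _ => ?_
    congr 2
    rw [← Circle.coe_pow, inv_circle_eq]
    have hc := (Complex.re_add_im ((c ^ j : Circle) : ℂ)).symm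
    simp only [inner_eq_sum, u, v]
    generalize ((c ^ j : Circle) : ℂ).re = α at *
    generalize ((c ^ j : Circle) : ℂ).im = β at *
    rw [hc]
    simp
    ring
  have h3 : ∫ x : BlochSphere, F x * ((x.1 0 + Complex.I * x.1 1) ^ m *
        trinomialCoeff l m (x.1 2) ((x.1 2 : ℂ) ^ 2 - 1)) ∂surfaceMeasure = 0 := by
    have h4 : ∫ x : BlochSphere, ∑ j ∈ Finset.range (2 * l + 1), (((c : ℂ) ^ j)⁻¹) ^ m *
      (F x * ((inner ℝ x.1 u : ℝ) + (inner ℝ x.1 (v j) : ℝ) * Complex.I) ^ l) ∂surfaceMeasure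
        = 0 := by
      rw [integral_finsetSum]
      · simp only [integral_const_mul, integral_mul_isotropic_pow hF h hu (hv _) (huv _), mul_zero,
          Finset.sum_const_zero]
      · intro j _
        refine (integrable_of_continuous (hF.mul (Continuous.pow ?_ l))).const_mul _
        exact (continuous_inner_complex u).add ((continuous_inner_complex _).mul continuous_const)
    simp only [mul_left_comm _ (F _), ← Finset.mul_sum, h1] at h4
    simp only [mul_left_comm (F _) ((2 * (l : ℂ) + 1) * (2 ^ l)⁻¹), integral_const_mul] at h4
    refine (mul_eq_zero.mp h4).resolve_left (mul_ne_zero ?_ (by simp))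
    exact_mod_cast hM
  have hfac : ((l + m).factorial : ℂ) ≠ 0 := by exact_mod_cast (l + m).factorial_ne_zero
  have hfac' : (l.factorial : ℂ) ≠ 0 := by exact_mod_cast l.factorial_ne_zero
  have h5 : ∀ x : BlochSphere, F x * sphericalHarmonicNat l m x =
      ((Real.sqrt ((2 * (l : ℝ) + 1) / (4 * Real.pi) *
      (((l - m).factorial : ℝ) / ((l + m).factorial : ℝ))) : ℂ) * (-1) ^ m *
      ((l + m).factorial / (2 ^ l * l.factorial))) *
      (F x * ((x.1 0 + Complex.I * x.1 1) ^ m *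
        trinomialCoeff l m (x.1 2) ((x.1 2 : ℂ) ^ 2 - 1))) := by
    intro x
    have h6 := trinomialCoeff_eq_legendre l m (x.1 2)
    rw [sphericalHarmonicNat]
    have h7 : ((((Polynomial.derivative^[m] (legendre l)).eval (x.1 2) : ℝ)) : ℂ) =
        ((l + m).factorial / (2 ^ l * l.factorial)) *
          trinomialCoeff l m (x.1 2) ((x.1 2 : ℂ) ^ 2 - 1) := by
      rw [div_mul_eq_mul_div, h6]
      field_simp
    rw [h7]
    ring
  simp only [h5, integral_const_mul, h3, mul_zero]

theorem harmonicCoeff_eq_zero {F : BlochSphere → ℝ} (hF : Continuous F) {l : ℕ}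
    (h : ∀ e : BlochSphere,
      ∫ x, (F x : ℂ) * (((legendre l).eval (inner ℝ x.1 e.1) : ℝ) : ℂ) ∂surfaceMeasure = 0)
    {m : ℤ} (hm : -(l : ℤ) ≤ m) (hm' : m ≤ l) : harmonicCoeff F l m = 0 := by
  have hF' : Continuous fun x => (F x : ℂ) := Complex.continuous_ofReal.comp hF
  have h1 := integral_mul_sphericalHarmonicNat hF' (show m.natAbs ≤ l by omega) h
  rw [harmonicCoeff]
  simp only [sphericalHarmonic]
  split_ifs with h0
  · have h2 := congrArg (starRingEnd ℂ) h1
    rw [← integral_conj, map_zero] at h2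
    rw [← h2]
    congr 1
    ext x
    rw [map_mul, Complex.conj_ofReal, mul_comm]
  · simp only [map_mul, Complex.conj_conj, mul_assoc, integral_const_mul]
    simp only [mul_comm (sphericalHarmonicNat _ _ _), h1, mul_zero]


/-! ### Legendre polynomials: coefficients and mean value -/

/-- For `F = 1` the integral of an isotropic power is `a 0 ^ l` times this one. The vectors `(1, 0,
i)` and `(0, 1, i)` are related by a rotation, yet give the factors 1 and 0. -/
theorem integral_legendre_axisX {l : ℕ} (hl : l ≠ 0) :
    ∫ x : BlochSphere, (((legendre l).eval (x.1 0) : ℝ) : ℂ) ∂surfaceMeasure = 0 := by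
  have h1 := fun (a : Fin 3 → ℂ) =>
    integral_zonalAverage_mul_dotC_pow (F := fun _ => 1) continuous_const l (a := a)
  have h0 : ∀ x, zonalAverage (fun _ => 1) x = 1 := by
    intro x
    simp [zonalAverage, measureReal_def]
  simp only [h0, one_mul] at h1
  have h2 := h1 ![1, 0, Complex.I] (by simp)
  have h3 := h1 ![0, 1, Complex.I] (by simp)
  rw [← integral_act (rotZ (Circle.exp (Real.pi / 2)))] at h3
  have h4 : ∀ x, dotC ![0, 1, Complex.I] (act (rotZ (Circle.exp (Real.pi / 2))) x) =
      dotC ![1, 0, Complex.I] x := by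
    intro x
    have h5 : ((Circle.exp (Real.pi / 2) : Circle) : ℂ) = Complex.I := by
      rw [Circle.coe_exp]
      push_cast
      exact Complex.exp_pi_div_two_mul_I
    simp only [dotC, coe_act, rotZ_apply, h5]
    simp
  simp only [h4] at h3
  rw [h3] at h2
  simpa [hl] using h2.symm

theorem integral_legendre_inner {l : ℕ} (hl : l ≠ 0) (e : BlochSphere) :
    ∫ x : BlochSphere, (((legendre l).eval (inner ℝ x.1 e.1) : ℝ) : ℂ) ∂surfaceMeasure = 0 := by
  obtain ⟨g, rfl⟩ := exists_act_eq axisX e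
  rw [← integral_act g]
  simp only [coe_act, LinearIsometryEquiv.inner_map_map, inner_axisX]
  exact integral_legendre_axisX hl

open Polynomial in
theorem legendre_coeff (l k : ℕ) : (legendre l).coeff k =
    ((2 : ℝ) ^ l * (l.factorial : ℝ))⁻¹ * ((k + l).descFactorial l *
      if 2 ∣ k + l then ((X - 1 : ℝ[X]) ^ l).coeff ((k + l) / 2) else 0) := by
  have h : ((X ^ 2 - 1) ^ l : ℝ[X]) = expand ℝ 2 ((X - 1) ^ l) := by simp
  rw [legendre, coeff_C_mul, coeff_iterate_derivative, nsmul_eq_mul, h, coeff_expand two_pos]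

theorem natDegree_X_sub_one_pow (l : ℕ) :
    ((Polynomial.X - 1 : Polynomial ℝ) ^ l).natDegree = l := by
  rw [← Polynomial.C_1, Polynomial.natDegree_pow, Polynomial.natDegree_X_sub_C, mul_one]

theorem legendre_coeff_ne_zero {l k : ℕ} (h : (legendre l).coeff k ≠ 0) : k ≤ l ∧ 2 ∣ k + l := by
  rw [legendre_coeff] at h
  split_ifs at h with h2
  · refine ⟨?_, h2⟩
    by_contra hk
    apply h
    rw [Polynomial.coeff_eq_zero_of_natDegree_lt]
    · simp
    · rw [natDegree_X_sub_one_pow]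
      omega
  · simp at h

theorem legendre_coeff_self_ne_zero (l : ℕ) : (legendre l).coeff l ≠ 0 := by
  have h1 : ((Polynomial.X - 1 : Polynomial ℝ) ^ l).coeff l = 1 := by
    have hm : ((Polynomial.X - 1 : Polynomial ℝ) ^ l).Monic := by
      rw [← Polynomial.C_1]
      exact (Polynomial.monic_X_sub_C _).pow l
    have := hm.coeff_natDegree
    rwa [natDegree_X_sub_one_pow] at this
  rw [legendre_coeff, if_pos ⟨l, by ring⟩, show (l + l) / 2 = l by omega, h1]
  have h2 : ((l + l).descFactorial l : ℝ) ≠ 0 := by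
    rw [Nat.cast_ne_zero, ne_eq, Nat.descFactorial_eq_zero_iff_lt]
    omega
  have h3 : (l.factorial : ℝ) ≠ 0 := by exact_mod_cast l.factorial_ne_zero
  positivity

theorem degree_legendre (l : ℕ) : (legendre l).degree = l := by
  refine le_antisymm ?_ (Polynomial.le_degree_of_ne_zero (legendre_coeff_self_ne_zero l))
  rw [Polynomial.degree_le_iff_coeff_zero]
  intro k hk
  by_contra h
  have := (legendre_coeff_ne_zero h).1
  rw [Nat.cast_lt] at hk
  omega

/-! ### Effects -/

theorem pauliDot_eq (n : E3) : pauliDot n =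
    !![(n 2 : ℂ), n 0 - n 1 * Complex.I; n 0 + n 1 * Complex.I, -(n 2 : ℂ)] := by
  ext i j
  fin_cases i <;> fin_cases j <;> simp [pauliDot, sub_eq_add_neg]

theorem one_add_pauliDot_eq (n : E3) : 1 + pauliDot n =
    !![1 + (n 2 : ℂ), n 0 - n 1 * Complex.I; n 0 + n 1 * Complex.I, 1 - (n 2 : ℂ)] := by
  rw [pauliDot_eq, Matrix.one_fin_two]
  ext i j
  fin_cases i <;> fin_cases j <;> simp [sub_eq_add_neg]

/-- `1 + n · σ` is twice a projection, as `(n · σ) ^ 2 = 1`; the factored form yields positivity. -/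
theorem one_add_pauliDot_eq_smul_conjTranspose_mul_self (n : BlochSphere) :
    (1 + pauliDot n.1 : QubitOp) =
      ((1 / 2 : ℝ) : ℂ) • ((1 + pauliDot n.1 : QubitOp).conjTranspose * (1 + pauliDot n.1)) := by
  have hx := sum_sq_coord_complex n
  rw [one_add_pauliDot_eq]
  ext i j
  fin_cases i <;> fin_cases j <;>
    simp [Matrix.mul_apply, Fin.sum_univ_two, Matrix.conjTranspose_apply]
  · linear_combination (-1 / 2 : ℂ) * hx + (1 / 2 : ℂ) * (n.1 1 : ℂ) ^ 2 * Complex.I_sq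
  · ring
  · ring
  · linear_combination (-1 / 2 : ℂ) * hx + (1 / 2 : ℂ) * (n.1 1 : ℂ) ^ 2 * Complex.I_sq

theorem posSemidef_one_add_pauliDot (n : BlochSphere) :
    (1 + pauliDot n.1 : QubitOp).PosSemidef := by
  rw [one_add_pauliDot_eq_smul_conjTranspose_mul_self]
  refine (Matrix.posSemidef_conjTranspose_mul_self _).smul ?_
  exact_mod_cast (by norm_num : (0 : ℝ) ≤ 1 / 2)

theorem posSemidef_effect (N : ℕ) (n : BlochSphere) : (effect N n).PosSemidef := by
  refine (posSemidef_one_add_pauliDot n).smul ?_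
  rw [← Complex.ofReal_natCast, ← Complex.ofReal_inv]
  exact_mod_cast (by positivity : (0 : ℝ) ≤ (N : ℝ)⁻¹)

theorem pauliDot_add (x y : E3) : pauliDot (x + y) = pauliDot x + pauliDot y := by
  simp only [pauliDot, PiLp.add_apply, Complex.ofReal_add, add_smul]
  abel

theorem pauliDot_smul (r : ℝ) (x : E3) : pauliDot (r • x) = (r : ℂ) • pauliDot x := by
  simp only [pauliDot, PiLp.smul_apply, smul_eq_mul, Complex.ofReal_mul, smul_add, smul_smul]

theorem pauliDot_zero : pauliDot 0 = 0 := by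
  simp [pauliDot]

theorem sum_pauliDot {ι : Type*} (s : Finset ι) (x : ι → E3) :
    ∑ j ∈ s, pauliDot (x j) = pauliDot (∑ j ∈ s, x j) :=
  (map_sum (⟨⟨pauliDot, pauliDot_zero⟩, pauliDot_add⟩ : E3 →+ QubitOp) x s).symm

theorem trace_mul_effect_apply (N : ℕ) (W : QubitOp) (n : BlochSphere) :
    (W * effect N n).trace = (N : ℂ)⁻¹ * (W 0 0 * (1 + n.1 2) + W 0 1 * (n.1 0 + n.1 1 * Complex.I)
      + W 1 0 * (n.1 0 - n.1 1 * Complex.I) + W 1 1 * (1 - n.1 2)) := by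
  rw [effect, one_add_pauliDot_eq, Matrix.mul_smul, Matrix.trace_smul, Matrix.trace_fin_two,
    smul_eq_mul]
  simp [Matrix.mul_apply, Fin.sum_univ_two]
  left
  ring

/-! ### Frame functions are balanced up to a constant -/

theorem sum_polygonVertex {N : ℕ} (hN : 3 ≤ N) :
    ∑ j : Fin N, (polygonVertex N j).1 = 0 := by
  have h : ∀ a b : ℝ, ∑ j : Fin N, (a * Real.cos (2 * Real.pi * (j : ℕ) / N) +
      b * Real.sin (2 * Real.pi * (j : ℕ) / N)) = 0 := by
    intro a b
    have := sum_cos_sin_pow_eq_zero (N := N) (k := 1) odd_one (Or.inr (by omega)) (by omega) a b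
    rw [Finset.sum_range] at this
    simpa only [pow_one] using this
  have hc := h 1 0
  have hs := h 0 1
  simp only [one_mul, zero_mul, add_zero, zero_add] at hc hs
  ext i
  rw [WithLp.ofLp_sum, Finset.sum_apply]
  fin_cases i
  · simpa [polygonVertex] using hc
  · simpa [polygonVertex] using hs
  · simp [polygonVertex]

theorem isPolygonPOVM_act {N : ℕ} (hN : 3 ≤ N) (g : E3 ≃ₗᵢ[ℝ] E3) :
    IsPolygonPOVM (fun j : Fin N => allowedEffect N (act g (polygonVertex N j))) := by
  refine ⟨⟨fun j => posSemidef_effect N _, ?_⟩, fun j => act g (polygonVertex N j), ?_,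
    fun j => rfl⟩
  · have h1 : ∑ j : Fin N, pauliDot (act g (polygonVertex N j)).1 = 0 := by
      simp only [sum_pauliDot, coe_act, ← map_sum, sum_polygonVertex hN, map_zero, pauliDot_zero]
    simp only [allowedEffect, effect, ← Finset.smul_sum, Finset.sum_add_distrib, h1]
    have : (N : ℂ) ≠ 0 := by
      rw [Nat.cast_ne_zero]
      omega
    rw [add_zero, Finset.sum_const, Finset.card_univ, Fintype.card_fin,
      ← Nat.cast_smul_eq_nsmul ℂ, smul_smul, inv_mul_cancel₀ this, one_smul]
  · refine ⟨0, g (EuclideanSpace.single 0 1), g (EuclideanSpace.single 1 1), 1, one_pos, by simp,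
      by simp, ?_, fun j => ?_⟩
    · rw [LinearIsometryEquiv.inner_map_map]
      simp [inner_eq_sum]
    · rw [zero_add, one_smul, ← map_smul, ← map_smul, ← map_add]
      refine congrArg g ?_
      ext i
      fin_cases i <;> simp [polygonVertex]

theorem IsFrameFunction.isBalanced {N : ℕ} (hN : 3 ≤ N) {f : AllowedEffect N → ℝ}
    (hf : IsFrameFunction f) : IsBalanced N (fun n => ((blochFunction f n - 1 / N : ℝ) : ℂ)) := by
  intro g
  have h := hf.normalized _ (isPolygonPOVM_act hN g)
  rw [Finset.sum_range, ← Complex.ofReal_sum, Finset.sum_sub_distrib]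
  simp only [blochFunction, h]
  have : (N : ℝ) ≠ 0 := by
    rw [Nat.cast_ne_zero]
    omega
  simp [this]

theorem exists_modEq_of_even_or {N l : ℕ} (h : Even l ∨ (Odd l ∧ Odd N ∧ N ≤ l)) :
    ∃ i, i ≤ l ∧ i ≡ l - i [MOD N] := by
  rcases h with ⟨c, rfl⟩ | ⟨⟨c, rfl⟩, ⟨d, rfl⟩, h⟩
  · exact ⟨c, by omega, by rw [Nat.add_sub_cancel]⟩
  -- This is `(l + N) / 2`, so that `i - (l - i) = N`; it is at most `l` because `N ≤ l`.
  · refine ⟨c + d + 1, by omega, ?_⟩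
    have : c + d + 1 = (2 * c + 1 - (c + d + 1)) + (2 * d + 1) := by omega
    conv_lhs => rw [this]
    simp [Nat.ModEq]

theorem IsFrameFunction.integral_sub_mul_legendre {N : ℕ} (hN : 3 ≤ N) {f : AllowedEffect N → ℝ}
    (hf : IsFrameFunction f) {l : ℕ} (h : Even l ∨ (Odd l ∧ Odd N ∧ N ≤ l)) (e : BlochSphere) :
    ∫ x, ((blochFunction f x - 1 / N : ℝ) : ℂ) *
      (((legendre l).eval (inner ℝ x.1 e.1) : ℝ) : ℂ) ∂surfaceMeasure = 0 := by
  obtain ⟨i, hi, hmod⟩ := exists_modEq_of_even_or h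
  exact (hf.isBalanced hN).integral_mul_legendre
    (Complex.continuous_ofReal.comp (hf.continuous.sub continuous_const))
    (sum_cos_pow_ne_zero (by omega) hi hmod) e

theorem IsFrameFunction.harmonicCoeff_eq_zero {N : ℕ} (hN : 3 ≤ N) {f : AllowedEffect N → ℝ}
    (hf : IsFrameFunction f) {l : ℕ} (h : Even l ∨ (Odd l ∧ Odd N ∧ N ≤ l)) (hl : l ≠ 0) {m : ℤ}
    (hm : -(l : ℤ) ≤ m) (hm' : m ≤ l) : harmonicCoeff (blochFunction f) l m = 0 := by
  refine QubitFrame.harmonicCoeff_eq_zero hf.continuous (fun e => ?_) hm hm'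
  have h1 := hf.integral_sub_mul_legendre hN h e
  have h2 := integral_legendre_inner hl e
  simp only [Complex.ofReal_sub, sub_mul] at h1
  rw [integral_sub, integral_const_mul, h2, mul_zero, sub_zero] at h1
  · exact h1
  · exact integrable_of_continuous
      ((Complex.continuous_ofReal.comp hf.continuous).mul (continuous_legendre_inner l _))
  · exact (integrable_of_continuous (continuous_legendre_inner l _)).const_mul _


/-! ### Frame functions that are polynomial in one coordinate -/

/-- The function of effects whose Bloch function is `1 / N + ε Q(n_z)`. -/
def axialFunction (N : ℕ) (ε : ℝ) (Q : Polynomial ℝ) (E : AllowedEffect N) : ℝ :=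
  1 / N + ε * Q.eval ((N * E.1 0 0).re - 1)

theorem re_effect_zero_zero {N : ℕ} (hN : N ≠ 0) (n : BlochSphere) :
    ((N : ℂ) * effect N n 0 0).re - 1 = n.1 2 := by
  have : (N : ℂ) ≠ 0 := Nat.cast_ne_zero.mpr hN
  rw [effect, one_add_pauliDot_eq]
  simp [this]

theorem blochFunction_axialFunction {N : ℕ} (hN : N ≠ 0) (ε : ℝ) (Q : Polynomial ℝ)
    (n : BlochSphere) :
    blochFunction (axialFunction N ε Q) n = 1 / N + ε * Q.eval (n.1 2) := by
  rw [blochFunction, axialFunction, allowedEffect, re_effect_zero_zero hN]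

/-- Cosines and sines sum to zero over the polygon, so the condition `∑ j, E j = 1` forces the third
coordinate of the centre to vanish. -/
theorem IsPolygonPOVM.exists_coord {N : ℕ} (hN : 3 ≤ N) {E : Fin N → AllowedEffect N}
    (hE : IsPolygonPOVM E) : ∃ a b : ℝ, ∀ j : Fin N, ((N : ℂ) * (E j).1 0 0).re - 1 =
      a * Real.cos (2 * Real.pi * (j : ℕ) / N) + b * Real.sin (2 * Real.pi * (j : ℕ) / N) := by
  obtain ⟨⟨-, hsum⟩, n, ⟨c, u, v, r, -, -, -, -, hn⟩, hEn⟩ := hE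
  have hN0 : N ≠ 0 := by omega
  have h1 : ∀ j : Fin N, ((N : ℂ) * (E j).1 0 0).re - 1 = c 2 +
      ((r * u 2) * Real.cos (2 * Real.pi * (j : ℕ) / N) +
        (r * v 2) * Real.sin (2 * Real.pi * (j : ℕ) / N)) := by
    intro j
    rw [hEn, allowedEffect, re_effect_zero_zero hN0]
    have := congrArg (fun x : E3 => x 2) (hn j)
    simp only [PiLp.add_apply, PiLp.smul_apply, smul_eq_mul] at this
    rw [this]
    ring
  have h2 : ∑ j : Fin N, (((N : ℂ) * (E j).1 0 0).re - 1) = 0 := by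
    have h3 := congrFun (congrFun hsum 0) 0
    rw [Matrix.sum_apply] at h3
    rw [Finset.sum_sub_distrib, ← Complex.re_sum, ← Finset.mul_sum, h3]
    simp
  have h4 := sum_cos_sin_pow_eq_zero (N := N) (k := 1) odd_one (Or.inr (by omega)) hN0
    (r * u 2) (r * v 2)
  rw [Finset.sum_range] at h4
  simp only [pow_one] at h4
  simp only [h1, Finset.sum_add_distrib (f := fun _ => c 2), h4, add_zero, Finset.sum_const,
    Finset.card_univ, Fintype.card_fin, nsmul_eq_mul, mul_eq_zero, Nat.cast_eq_zero, hN0,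
    false_or] at h2
  refine ⟨r * u 2, r * v 2, fun j => ?_⟩
  rw [h1, h2, zero_add]

theorem abs_coord_le_one (n : BlochSphere) (i : Fin 3) : |n.1 i| ≤ 1 := by
  have h := sum_sq_coord n
  rw [← sq_le_one_iff_abs_le_one]
  fin_cases i <;> simp only [Fin.reduceFinMk, Fin.zero_eta, Fin.mk_one] <;>
    nlinarith [sq_nonneg (n.1 0), sq_nonneg (n.1 1), sq_nonneg (n.1 2)]

theorem exists_isFrameFunction_axialFunction {N : ℕ} (hN : 3 ≤ N) (Q : Polynomial ℝ)
    (hQ : ∀ k, Q.coeff k ≠ 0 → Odd k ∧ (Even N ∨ k < N)) :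
    ∃ ε : ℝ, 0 < ε ∧ IsFrameFunction (axialFunction N ε Q) := by
  have hN0 : N ≠ 0 := by omega
  have hNpos : (0 : ℝ) < N := by exact_mod_cast Nat.pos_of_ne_zero hN0
  obtain ⟨B, hB⟩ := isCompact_Icc.exists_bound_of_continuousOn
    (Q.continuous.continuousOn (s := Set.Icc (-1 : ℝ) 1))
  have hB0 : 0 ≤ B := (norm_nonneg _).trans (hB 0 (by simp))
  -- With `|Q| ≤ B` on `[-1, 1]` the perturbation stays below `1 / N`, and the values lie in `[0, 2
  -- / N]`.
  refine ⟨1 / (N * (B + 1)), by positivity, ?_, ?_, ?_⟩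
  · rintro ⟨_, n, rfl⟩
    have h1 := blochFunction_axialFunction hN0 (1 / (N * (B + 1))) Q n
    rw [blochFunction, allowedEffect] at h1
    rw [h1]
    have h2 := hB (n.1 2) (abs_le.mp (abs_coord_le_one n 2))
    rw [Real.norm_eq_abs, abs_le] at h2
    have h3 : 1 / (N : ℝ) + 1 / (N * (B + 1)) * Q.eval (n.1 2) =
        (B + 1 + Q.eval (n.1 2)) / (N * (B + 1)) := by
      field_simp
    have h4 : (3 : ℝ) ≤ N := by exact_mod_cast hN
    rw [h3, Set.mem_Icc]
    constructor
    · apply div_nonneg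
      · linarith
      · positivity
    · rw [div_le_one (by positivity)]
      nlinarith
  · intro E hE
    obtain ⟨a, b, hab⟩ := hE.exists_coord hN
    have h1 : ∑ j : Fin N, Q.eval (a * Real.cos (2 * Real.pi * (j : ℕ) / N) +
        b * Real.sin (2 * Real.pi * (j : ℕ) / N)) = 0 := by
      simp only [Polynomial.eval_eq_sum_range]
      rw [Finset.sum_comm]
      refine Finset.sum_eq_zero fun k _ => ?_
      rw [← Finset.mul_sum]
      by_cases hk : Q.coeff k = 0
      · rw [hk, zero_mul]
      · have := sum_cos_sin_pow_eq_zero (hQ k hk).1 (hQ k hk).2 hN0 a b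
        rw [Finset.sum_range] at this
        rw [this, mul_zero]
    simp only [axialFunction, hab, Finset.sum_add_distrib, ← Finset.mul_sum, h1]
    simp [hN0]
  · have h1 : blochFunction (axialFunction N (1 / (N * (B + 1))) Q) =
        fun n => 1 / (N : ℝ) + 1 / (N * (B + 1)) * Q.eval (n.1 2) :=
      funext (blochFunction_axialFunction hN0 _ Q)
    rw [h1]
    exact continuous_const.add (continuous_const.mul (Q.continuous.comp (continuous_coord 2)))

/-- The third coordinate vector. -/
def axisZ : BlochSphere := ⟨EuclideanSpace.single 2 1, by simp⟩

theorem inner_axisZ (x : E3) : inner ℝ x axisZ.1 = x 2 := by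
  simp [inner_eq_sum, axisZ]

theorem sphericalHarmonic_zero (l : ℕ) (n : BlochSphere) : sphericalHarmonic l 0 n =
    ((Real.sqrt ((2 * (l : ℝ) + 1) / (4 * Real.pi)) * (legendre l).eval (n.1 2) : ℝ) : ℂ) := by
  have : (l.factorial : ℝ) ≠ 0 := by exact_mod_cast l.factorial_ne_zero
  simp [sphericalHarmonic, sphericalHarmonicNat, this]

theorem integral_legendre_sq_pos (l : ℕ) :
    0 < ∫ x : BlochSphere, (legendre l).eval (x.1 2) ^ 2 ∂surfaceMeasure := by
  have hc : Continuous fun x : BlochSphere => (legendre l).eval (x.1 2) ^ 2 :=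
    ((legendre l).continuous.comp (continuous_coord 2)).pow 2
  have hne : legendre l ≠ 0 := by
    intro h
    apply legendre_coeff_self_ne_zero l
    rw [h, Polynomial.coeff_zero]
  obtain ⟨t, ht, hroot⟩ : ∃ t ∈ Set.Icc (-1 : ℝ) 1, (legendre l).eval t ≠ 0 := by
    by_contra! h
    exact hne (Polynomial.eq_zero_of_infinite_isRoot _
      ((Set.Icc_infinite (by norm_num : (-1 : ℝ) < 1)).mono h))
  have hsq : 0 ≤ 1 - t ^ 2 := by nlinarith [ht.1, ht.2]
  let x : BlochSphere := ⟨!₂[√(1 - t ^ 2), 0, t], by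
    rw [mem_sphere_zero_iff_norm, EuclideanSpace.norm_eq, Real.sqrt_eq_one, Fin.sum_univ_three]
    simp [Real.sq_sqrt hsq]⟩
  refine hc.integral_pos_of_hasCompactSupport_nonneg_nonzero
    (HasCompactSupport.of_compactSpace _) (fun _ => sq_nonneg _) (x := x) ?_
  exact pow_ne_zero 2 hroot

theorem integral_legendre_axisZ_real {l : ℕ} (hl : l ≠ 0) :
    ∫ x : BlochSphere, (legendre l).eval (x.1 2) ∂surfaceMeasure = 0 := by
  have h := integral_legendre_inner hl axisZ
  simp only [inner_axisZ] at h
  rwa [integral_complex_ofReal, Complex.ofReal_eq_zero] at h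

theorem integrable_of_continuous_real {f : BlochSphere → ℝ} (hf : Continuous f) :
    Integrable f surfaceMeasure :=
  hf.integrable_of_hasCompactSupport (HasCompactSupport.of_compactSpace f)

theorem harmonicCoeff_zero_ne_zero {l : ℕ} {F : BlochSphere → ℝ} {c ε : ℝ}
    (hF : ∀ x, F x = c + ε * (legendre l).eval (x.1 2)) (hl : l ≠ 0) (hε : ε ≠ 0) :
    harmonicCoeff F l 0 ≠ 0 := by
  have hP : Continuous fun x : BlochSphere => (legendre l).eval (x.1 2) :=
    (legendre l).continuous.comp (continuous_coord 2)
  have hP2 : Continuous fun x : BlochSphere => (legendre l).eval (x.1 2) ^ 2 := hP.pow 2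
  have h1 : harmonicCoeff F l 0 = ((∫ x : BlochSphere,
      (Real.sqrt ((2 * (l : ℝ) + 1) / (4 * Real.pi)) * c * (legendre l).eval (x.1 2) +
      Real.sqrt ((2 * (l : ℝ) + 1) / (4 * Real.pi)) * ε * (legendre l).eval (x.1 2) ^ 2)
        ∂surfaceMeasure : ℝ) : ℂ) := by
    rw [harmonicCoeff, ← integral_complex_ofReal]
    congr 1
    ext x
    rw [sphericalHarmonic_zero, Complex.conj_ofReal, hF, ← Complex.ofReal_mul]
    congr 1
    ring
  rw [h1, Complex.ofReal_ne_zero, integral_add ((integrable_of_continuous_real hP).const_mul _)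
    ((integrable_of_continuous_real hP2).const_mul _), integral_const_mul,
    integral_const_mul, integral_legendre_axisZ_real hl, mul_zero, zero_add]
  refine mul_ne_zero (mul_ne_zero ?_ hε) (integral_legendre_sq_pos l).ne'
  have := Real.pi_pos
  positivity

/-! ### The allowed harmonics -/

theorem allowedHarmonic_zero {N : ℕ} (hN : 3 ≤ N) : AllowedHarmonic N 0 := by
  have hN0 : N ≠ 0 := by omega
  obtain ⟨ε, -, hf⟩ := exists_isFrameFunction_axialFunction hN 0 (by simp)
  refine ⟨_, hf, 0, by simp, by simp, ?_⟩
  have hleg : legendre 0 = 1 := by simp [legendre]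
  have hpos := integral_legendre_sq_pos 0
  have h1 : harmonicCoeff (blochFunction (axialFunction N ε 0)) 0 0 =
      ((Real.sqrt (1 / (4 * Real.pi)) * (1 / N) *
        ∫ x : BlochSphere, (legendre 0).eval (x.1 2) ^ 2 ∂surfaceMeasure : ℝ) : ℂ) := by
    rw [harmonicCoeff, ← integral_const_mul, ← integral_complex_ofReal]
    congr 1
    ext x
    rw [sphericalHarmonic_zero, Complex.conj_ofReal, blochFunction_axialFunction hN0,
      ← Complex.ofReal_mul, hleg]
    congr 1
    simp
  rw [h1, Complex.ofReal_ne_zero]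
  refine mul_ne_zero (mul_ne_zero ?_ ?_) hpos.ne'
  · have := Real.pi_pos
    positivity
  · positivity

theorem allowedHarmonic_of_odd {N l : ℕ} (hN : 3 ≤ N) (hl : Odd l) (h : Even N ∨ l < N) :
    AllowedHarmonic N l := by
  have hN0 : N ≠ 0 := by omega
  obtain ⟨ε, hε, hf⟩ := exists_isFrameFunction_axialFunction hN (legendre l) (by
    intro k hk
    obtain ⟨h1, h2⟩ := legendre_coeff_ne_zero hk
    refine ⟨?_, h.imp_right fun h => by omega⟩
    rw [← even_iff_two_dvd, Nat.even_add] at h2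
    rw [← Nat.not_even_iff_odd] at hl ⊢
    exact fun h3 => hl (h2.mp h3))
  exact ⟨_, hf, 0, by simp, by simp, harmonicCoeff_zero_ne_zero
    (blochFunction_axialFunction hN0 ε _) (by rintro rfl; simp at hl) hε.ne'⟩

theorem allowedHarmonic_iff {N : ℕ} (hN : 3 ≤ N) (l : ℕ) :
    AllowedHarmonic N l ↔ l = 0 ∨ (Odd l ∧ (Even N ∨ l < N)) := by
  constructor
  · rintro ⟨f, hf, m, hm, hm', hne⟩
    by_contra! h
    refine hne (hf.harmonicCoeff_eq_zero hN ?_ h.1 hm hm')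
    rcases Nat.even_or_odd l with hl | hl
    · exact Or.inl hl
    · have := h.2 hl
      rw [Nat.not_even_iff_odd] at this
      exact Or.inr ⟨hl, this⟩
  · rintro (rfl | ⟨h, h'⟩)
    · exact allowedHarmonic_zero hN
    · exact allowedHarmonic_of_odd hN h h'


/-! ### The quantum probability rule -/

theorem trace_mul_effect_nonneg (N : ℕ) {W : QubitOp} (hW : W.PosSemidef) (n : BlochSphere) :
    0 ≤ (W * effect N n).trace := by
  rw [effect, one_add_pauliDot_eq_smul_conjTranspose_mul_self, smul_smul, Matrix.mul_smul,
    Matrix.trace_smul, ← Matrix.mul_assoc, Matrix.trace_mul_comm, ← Matrix.mul_assoc, smul_eq_mul]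
  refine mul_nonneg ?_ (hW.mul_mul_conjTranspose_same _).trace_nonneg
  rw [← Complex.ofReal_natCast, ← Complex.ofReal_inv, ← Complex.ofReal_mul]
  exact_mod_cast (by positivity : (0 : ℝ) ≤ (N : ℝ)⁻¹ * (1 / 2))

theorem effect_add_effect_neg (N : ℕ) (n : BlochSphere) :
    effect N n + effect N (-n) = (2 * (N : ℂ)⁻¹) • (1 : QubitOp) := by
  rw [effect, effect, one_add_pauliDot_eq, one_add_pauliDot_eq, Matrix.one_fin_two]
  ext i j
  fin_cases i <;> fin_cases j <;> simp <;> ring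

theorem ObeysQuantumRule.isFrameFunction {N : ℕ} (hN : 3 ≤ N) {f : AllowedEffect N → ℝ}
    (hf : ObeysQuantumRule f) : IsFrameFunction f := by
  obtain ⟨W, ⟨hW, htr⟩, hfW⟩ := hf
  have hnonneg : ∀ n : BlochSphere, 0 ≤ f (allowedEffect N n) := by
    intro n
    have := trace_mul_effect_nonneg N hW n
    have h2 := hfW (allowedEffect N n)
    rw [allowedEffect] at h2 ⊢
    rw [← h2] at this
    exact_mod_cast this
  refine ⟨?_, ?_, ?_⟩
  · rintro ⟨_, n, rfl⟩
    refine ⟨hnonneg n, ?_⟩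
    -- The upper bound follows from nonnegativity at the antipode, since `2 / N ≤ 1`.
    have h1 : f (allowedEffect N n) + f (allowedEffect N (-n)) = 2 / N := by
      rw [← Complex.ofReal_inj]
      push_cast
      rw [hfW, hfW, ← Matrix.trace_add, ← Matrix.mul_add]
      simp only [allowedEffect]
      rw [effect_add_effect_neg, Matrix.mul_smul, Matrix.mul_one, Matrix.trace_smul, htr]
      simp [div_eq_mul_inv]
    have h2 := hnonneg (-n)
    have h3 : (2 : ℝ) / N ≤ 1 := by
      have : (3 : ℝ) ≤ N := by exact_mod_cast hN
      rw [div_le_one (by linarith)]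
      linarith
    rw [allowedEffect] at h1
    linarith
  · rintro E ⟨⟨-, hsum⟩, -⟩
    rw [← Complex.ofReal_inj, Complex.ofReal_sum]
    simp only [hfW]
    rw [← Matrix.trace_sum, ← Finset.mul_sum, hsum, mul_one, htr, Complex.ofReal_one]
  · have h1 : blochFunction f = fun n => ((W * effect N n).trace).re := by
      ext n
      have := congrArg Complex.re (hfW (allowedEffect N n))
      exact this
    rw [h1]
    simp only [trace_mul_effect_apply]
    have hc := fun i => Complex.continuous_ofReal.comp (continuous_coord i)
    refine Complex.continuous_re.comp (continuous_const.mul ?_)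
    have h0 := hc 0
    have h1 := hc 1
    have h2 := hc 2
    simp only [Function.comp_def] at h0 h1 h2
    fun_prop

theorem exists_not_obeysQuantumRule {N : ℕ} (hN : 3 ≤ N) (hN3 : N ≠ 3) :
    ∃ f : AllowedEffect N → ℝ, IsFrameFunction f ∧ ¬ ObeysQuantumRule f := by
  have hN0 : N ≠ 0 := by omega
  obtain ⟨ε, hε, hf⟩ := exists_isFrameFunction_axialFunction hN (Polynomial.X ^ 3) (by
    intro k hk
    rw [Polynomial.coeff_X_pow] at hk
    obtain rfl : k = 3 := by
      by_contra h
      simp [h] at hk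
    exact ⟨by decide, Or.inr (by omega)⟩)
  refine ⟨_, hf, ?_⟩
  rintro ⟨W, -, hW⟩
  have h1 : ∀ n : BlochSphere, 1 / (N : ℂ) + ε * (n.1 2 : ℂ) ^ 3 = (N : ℂ)⁻¹ *
      (W 0 0 * (1 + n.1 2) + W 0 1 * (n.1 0 + n.1 1 * Complex.I)
      + W 1 0 * (n.1 0 - n.1 1 * Complex.I) + W 1 1 * (1 - n.1 2)) := by
    intro n
    have h2 := blochFunction_axialFunction hN0 ε (Polynomial.X ^ 3) n
    rw [blochFunction] at h2
    have h3 := hW (allowedEffect N n)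
    rw [h2, allowedEffect, trace_mul_effect_apply] at h3
    rw [← h3]
    simp
  -- The value `axisZ` only makes `p` total; it is used only on the unit circle.
  let p : ℝ → ℝ → BlochSphere := fun a b => if h : a ^ 2 + b ^ 2 = 1 then ⟨!₂[a, 0, b], by
    rw [mem_sphere_zero_iff_norm, EuclideanSpace.norm_eq, Real.sqrt_eq_one, Fin.sum_univ_three]
    simpa using h⟩ else axisZ
  have hp : ∀ a b : ℝ, a ^ 2 + b ^ 2 = 1 → 1 / (N : ℂ) + ε * (b : ℂ) ^ 3 = (N : ℂ)⁻¹ *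
      (W 0 0 * (1 + b) + W 0 1 * a + W 1 0 * a + W 1 1 * (1 - b)) := by
    intro a b hab
    have := h1 (p a b)
    simpa [p, hab] using this
  have e1 := hp 0 1 (by norm_num)
  have e2 := hp 0 (-1) (by norm_num)
  have e3 := hp (3 / 5) (4 / 5) (by norm_num)
  have e4 := hp (-3 / 5) (4 / 5) (by norm_num)
  push_cast at e1 e2 e3 e4
  have : (ε : ℂ) = 0 := by
    -- This combination annihilates affine functions; on `b ^ 3` it gives `2 (4/5) ^ 3 - 8/5 =
    -- -72/125`.
    linear_combination (-125 / 72 : ℂ) * (e3 + e4 - (e1 + e2) - (4 / 5) * (e1 - e2))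
  exact hε.ne' (by exact_mod_cast this)

/-! ### Frame functions for the trine -/

/-- The Legendre polynomials as a polynomial sequence. -/
def legendreSequence : Polynomial.Sequence ℝ := ⟨legendre, degree_legendre⟩

theorem legendre_one : legendre 1 = Polynomial.X := by
  have h : Polynomial.derivative (Polynomial.X ^ 2 - 1 : Polynomial ℝ) =
      Polynomial.C 2 * Polynomial.X := by
    simp only [Polynomial.derivative_sub, Polynomial.derivative_X_pow, Polynomial.derivative_one,
      sub_zero, Nat.add_one_sub_one, pow_one, Nat.cast_ofNat]
  rw [legendre]
  simp only [Function.iterate_one, pow_one, h, Nat.factorial_one, Nat.cast_one, mul_one,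
    ← mul_assoc, ← Polynomial.C_mul]
  norm_num

theorem continuous_eval_inner (p : Polynomial ℝ) (e : E3) :
    Continuous fun x : BlochSphere => p.eval (inner ℝ x.1 e) :=
  p.continuous.comp (by fun_prop)

/-- Expanded in Legendre polynomials, `p` contributes only its component along `P_1 = X`. The point
is that `c` does not depend on `e`. -/
theorem exists_integral_mul_eval {F : BlochSphere → ℝ} (hF : Continuous F)
    (h : ∀ l, l ≠ 1 → ∀ e : BlochSphere,
      ∫ x, F x * (legendre l).eval (inner ℝ x.1 e.1) ∂surfaceMeasure = 0) (p : Polynomial ℝ) :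
    ∃ c : ℝ, ∀ e : BlochSphere, ∫ x, F x * p.eval (inner ℝ x.1 e.1) ∂surfaceMeasure =
      c * ∫ x, F x * inner ℝ x.1 e.1 ∂surfaceMeasure := by
  have hint : ∀ (p : Polynomial ℝ) (e : BlochSphere),
      Integrable (fun x => F x * p.eval (inner ℝ x.1 e.1)) surfaceMeasure := fun p e =>
    integrable_of_continuous_real (hF.mul (continuous_eval_inner p _))
  have hp : p ∈ Submodule.span ℝ (Set.range legendreSequence) := by
    rw [legendreSequence.span fun i => IsUnit.mk0 _ (Polynomial.leadingCoeff_ne_zero.mpr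
      (legendreSequence.ne_zero i))]
    trivial
  induction hp using Submodule.span_induction with
  | mem p hp =>
    obtain ⟨l, rfl⟩ := hp
    by_cases hl : l = 1
    · subst hl
      refine ⟨1, fun e => ?_⟩
      have : legendreSequence 1 = Polynomial.X := legendre_one
      simp [this]
    · exact ⟨0, fun e => by rw [zero_mul]; exact h l hl e⟩
  | zero => exact ⟨0, fun e => by simp⟩
  | add p q _ _ hp hq =>
    obtain ⟨c, hc⟩ := hp
    obtain ⟨d, hd⟩ := hq
    refine ⟨c + d, fun e => ?_⟩
    simp only [Polynomial.eval_add, mul_add]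
    rw [integral_add (hint p e) (hint q e), hc, hd, add_mul]
  | smul a p _ hp =>
    obtain ⟨c, hc⟩ := hp
    refine ⟨a * c, fun e => ?_⟩
    simp only [Polynomial.eval_smul, smul_eq_mul, mul_left_comm _ a]
    rw [integral_const_mul, hc, mul_assoc]

/-- `1 + x · e` is nonnegative with its unique maximum at `x = e`, so its normalized powers
concentrate there. -/
theorem tendsto_peak {F : BlochSphere → ℝ} (hF : Continuous F) (e : BlochSphere) :
    Filter.Tendsto (fun n : ℕ => (∫ x : BlochSphere, (1 + inner ℝ x.1 e.1) ^ n ∂surfaceMeasure)⁻¹ *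
      ∫ x : BlochSphere, F x * (1 + inner ℝ x.1 e.1) ^ n ∂surfaceMeasure) Filter.atTop
      (nhds (F e)) := by
  have hone : ∀ x : BlochSphere, ‖x.1‖ = 1 := fun x => by simp
  have hc : Continuous fun x : BlochSphere => 1 + inner ℝ x.1 e.1 :=
    continuous_const.add (by fun_prop)
  have h := tendsto_setIntegral_pow_smul_of_unique_maximum_of_isCompact_of_continuousOn
    (μ := surfaceMeasure) (s := Set.univ) (x₀ := e) (g := F)
    (c := fun x : BlochSphere => 1 + inner ℝ x.1 e.1) isCompact_univ hc.continuousOn ?_ ?_ ?_ ?_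
    hF.continuousOn
  · simp only [Measure.restrict_univ, smul_eq_mul] at h
    simpa only [mul_comm (F _)] using h
  · intro y _ hy
    have h1 := (inner_lt_one_iff_real_of_norm_eq_one (hone y) (hone e)).mpr
      (fun h => hy (Subtype.ext h))
    rw [real_inner_self_eq_norm_sq, hone]
    linarith
  · intro x _
    have := (abs_le.mp (abs_real_inner_le_norm x.1 e.1)).1
    rw [hone, hone] at this
    linarith
  · rw [real_inner_self_eq_norm_sq, hone]
    norm_num
  · simp

theorem integral_one_add_inner_pow (n : ℕ) (e : BlochSphere) :
    ∫ x : BlochSphere, (1 + inner ℝ x.1 e.1) ^ n ∂surfaceMeasure =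
      ∫ x : BlochSphere, (1 + inner ℝ x.1 axisX.1) ^ n ∂surfaceMeasure := by
  obtain ⟨g, rfl⟩ := exists_act_eq axisX e
  rw [← integral_act g]
  simp only [coe_act, LinearIsometryEquiv.inner_map_map]

/-- A continuous function without harmonics of degree other than one is linear. -/
theorem exists_eq_inner {F : BlochSphere → ℝ} (hF : Continuous F)
    (h : ∀ l, l ≠ 1 → ∀ e : BlochSphere,
      ∫ x, F x * (legendre l).eval (inner ℝ x.1 e.1) ∂surfaceMeasure = 0) :
    ∃ b : E3, ∀ e : BlochSphere, F e = inner ℝ b e.1 := by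
  have hlim : ∃ κ : ℕ → ℝ, ∀ e : BlochSphere, Filter.Tendsto
      (fun n => κ n * ∫ x, F x * inner ℝ x.1 e.1 ∂surfaceMeasure) Filter.atTop (nhds (F e)) := by
    choose c hc using fun n : ℕ =>
      exists_integral_mul_eval hF h ((1 + Polynomial.X : Polynomial ℝ) ^ n)
    refine ⟨fun n => (∫ x : BlochSphere, (1 + inner ℝ x.1 axisX.1) ^ n ∂surfaceMeasure)⁻¹ * c n,
      fun e => ?_⟩
    have := tendsto_peak hF e
    simp only [Polynomial.eval_pow, Polynomial.eval_add, Polynomial.eval_one,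
      Polynomial.eval_X] at hc
    simp only [hc, integral_one_add_inner_pow _ e, ← mul_assoc] at this
    exact this
  obtain ⟨κ, hκ⟩ := hlim
  let b : E3 := !₂[∫ x, F x * x.1 0 ∂surfaceMeasure, ∫ x, F x * x.1 1 ∂surfaceMeasure,
    ∫ x, F x * x.1 2 ∂surfaceMeasure]
  have hb : ∀ e : BlochSphere, ∫ x, F x * inner ℝ x.1 e.1 ∂surfaceMeasure = inner ℝ b e.1 := by
    intro e
    have hi : ∀ i, Integrable (fun x : BlochSphere => F x * x.1 i * e.1 i) surfaceMeasure :=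
      fun i => integrable_of_continuous_real
        ((hF.mul (continuous_coord i)).mul continuous_const)
    simp only [inner_eq_sum, mul_add, ← mul_assoc]
    have h01 : Integrable (fun x : BlochSphere => F x * x.1 0 * e.1 0 + F x * x.1 1 * e.1 1)
      surfaceMeasure := (hi 0).add (hi 1)
    rw [integral_add h01 (hi 2), integral_add (hi 0) (hi 1), integral_mul_const,
      integral_mul_const, integral_mul_const]
    simp [b]
  simp only [hb] at hκ
  by_cases hb0 : b = 0
  · refine ⟨0, fun e => ?_⟩
    have := hκ e
    simp only [hb0, inner_zero_left, mul_zero] at this ⊢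
    exact tendsto_nhds_unique this tendsto_const_nhds
  · have hn : ‖b‖ ≠ 0 := norm_ne_zero_iff.mpr hb0
    -- At this point the linear factor is nonzero, so the scalars `κ n` themselves converge.
    let e₀ : BlochSphere := ⟨‖b‖⁻¹ • b, by simp [norm_smul, hn]⟩
    have h0 : inner ℝ b e₀.1 = ‖b‖ := by
      simp only [e₀, inner_smul_right, real_inner_self_eq_norm_sq]
      field_simp
    have h1 := (hκ e₀).mul_const ‖b‖⁻¹
    simp only [h0, mul_assoc, mul_inv_cancel₀ hn, mul_one] at h1
    refine ⟨(F e₀ * ‖b‖⁻¹) • b, fun e => ?_⟩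
    rw [real_inner_smul_left]
    exact tendsto_nhds_unique (hκ e) (h1.mul_const _)

/-- A point of the Bloch ball is a convex combination of the centre and a point of the sphere. -/
theorem posSemidef_one_add_pauliDot_of_norm_le {w : E3} (hw : ‖w‖ ≤ 1) :
    (1 + pauliDot w : QubitOp).PosSemidef := by
  by_cases h0 : w = 0
  · rw [h0, pauliDot_zero, add_zero]
    exact Matrix.PosSemidef.one
  · have hn : ‖w‖ ≠ 0 := norm_ne_zero_iff.mpr h0
    let e : BlochSphere := ⟨‖w‖⁻¹ • w, by simp [norm_smul, hn]⟩
    have h1 : (1 + pauliDot w : QubitOp) =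
        ((1 - ‖w‖ : ℝ) : ℂ) • (1 : QubitOp) + ((‖w‖ : ℝ) : ℂ) • (1 + pauliDot e.1) := by
      have : w = ‖w‖ • e.1 := by simp [e, smul_smul, hn]
      conv_lhs => rw [this, pauliDot_smul]
      rw [smul_add, ← add_assoc, ← add_smul]
      simp
    rw [h1]
    refine (Matrix.PosSemidef.one.smul ?_).add ((posSemidef_one_add_pauliDot e).smul ?_)
    · exact_mod_cast sub_nonneg.mpr hw
    · exact_mod_cast norm_nonneg w

theorem IsFrameFunction.obeysQuantumRule_of_trine {f : AllowedEffect 3 → ℝ}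
    (hf : IsFrameFunction f) : ObeysQuantumRule f := by
  obtain ⟨b, hb⟩ := exists_eq_inner (F := fun x => blochFunction f x - 1 / (3 : ℕ))
    (hf.continuous.sub continuous_const) (by
      intro l hl e
      have h := hf.integral_sub_mul_legendre le_rfl (l := l) (by
        rcases Nat.even_or_odd l with h | h
        · exact Or.inl h
        · refine Or.inr ⟨h, by decide, ?_⟩
          obtain ⟨c, rfl⟩ := h
          omega) e
      simp only [← Complex.ofReal_mul] at h
      rwa [integral_complex_ofReal, Complex.ofReal_eq_zero] at h)
  have hval : ∀ n : BlochSphere, f (allowedEffect 3 n) = 1 / 3 + inner ℝ b n.1 := by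
    intro n
    have := hb n
    simp only [blochFunction, Nat.cast_ofNat] at this
    linarith
  have hnorm : ‖(3 : ℝ) • b‖ ≤ 1 := by
    rw [norm_smul, Real.norm_ofNat]
    by_cases h0 : b = 0
    · simp [h0]
    · have hn : ‖b‖ ≠ 0 := norm_ne_zero_iff.mpr h0
      let e : BlochSphere := ⟨‖b‖⁻¹ • b, by simp [norm_smul, hn]⟩
      -- Nonnegativity where the linear part is smallest gives `1 / 3 - ‖b‖ ≥ 0`.
      have h1 := (hf.mem_Icc (allowedEffect 3 (-e))).1
      have h2 : inner ℝ b e.1 = ‖b‖ := by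
        simp only [e, inner_smul_right, real_inner_self_eq_norm_sq]
        field_simp
      have h3 : inner ℝ b (-e).1 = -‖b‖ := by
        rw [← h2, ← inner_neg_right]
        rfl
      rw [hval, h3] at h1
      linarith
  -- The Bloch vector is `3 b` because the rule gives `(1 + w · n) / 3` for the Bloch vector `w`.
  refine ⟨((1 / 2 : ℝ) : ℂ) • (1 + pauliDot ((3 : ℝ) • b)), ⟨?_, ?_⟩, ?_⟩
  · refine (posSemidef_one_add_pauliDot_of_norm_le hnorm).smul ?_
    exact_mod_cast (by norm_num : (0 : ℝ) ≤ 1 / 2)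
  · rw [one_add_pauliDot_eq, Matrix.trace_smul, Matrix.trace_fin_two]
    simp
    norm_num
  · rintro ⟨_, n, rfl⟩
    have h := hval n
    rw [allowedEffect] at h
    rw [h, trace_mul_effect_apply, one_add_pauliDot_eq, inner_eq_sum]
    simp
    linear_combination (b 1 : ℂ) * n.1 1 * Complex.I_sq

theorem forall_obeysQuantumRule_iff {N : ℕ} (hN : 3 ≤ N) :
    (∀ f : AllowedEffect N → ℝ, IsFrameFunction f → ObeysQuantumRule f) ↔ N = 3 := by
  constructor
  · intro h
    by_contra hne
    obtain ⟨f, hf, hf'⟩ := exists_not_obeysQuantumRule hN hne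
    exact hf' (h f hf)
  · rintro rfl f hf
    exact hf.obeysQuantumRule_of_trine

end QubitFrame

end

theorem mainTheorem6 (N : ℕ) (hN : 3 ≤ N) :
    (Even N → ∀ l : ℕ, QubitFrame.AllowedHarmonic N l ↔ l = 0 ∨ Odd l) ∧
    (Odd N → ∀ l : ℕ, QubitFrame.AllowedHarmonic N l ↔ l = 0 ∨ (Odd l ∧ l ≤ N - 2)) ∧
    (∀ f : QubitFrame.AllowedEffect N → ℝ,
      QubitFrame.ObeysQuantumRule f → QubitFrame.IsFrameFunction f) ∧
    ((∀ f : QubitFrame.AllowedEffect N → ℝ,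
      QubitFrame.IsFrameFunction f → QubitFrame.ObeysQuantumRule f) ↔ N = 3) := by
  refine ⟨fun hev l => ?_, fun hodd l => ?_, fun f hf => hf.isFrameFunction hN,
    QubitFrame.forall_obeysQuantumRule_iff hN⟩
  · rw [QubitFrame.allowedHarmonic_iff hN]
    simp [hev]
  · rw [QubitFrame.allowedHarmonic_iff hN]
    have hne : ¬ Even N := Nat.not_even_iff_odd.mpr hodd
    refine or_congr_right (and_congr_right fun hl => ?_)
    simp only [hne, false_or]
    obtain ⟨a, rfl⟩ := hodd
    obtain ⟨b, rfl⟩ := hl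
    omega
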